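/- Let $U$ be a compact simply connected flat surface, possibly with boundary and without conic singularities, and let $z:U\to\mathbb C$ be a flat coordinate: a continuous, locally injective map which is a local isometry for the flat metric (not necessarily globally injective). A *critical map* of $U$ with side length $\delta>0$ is a finite cellular decomposition of $U$ whose faces are carried injectively by $z$ onto non-degenerate lozenges of side $\delta$ in $\mathbb C$; two distinct faces are disjoint or meet exactly in a common vertex or exactly in a common side. For a function $f$ on the vertices and a side $(x,y)$ of a lozenge put $$\int_{(x,y)} f\,dZ:=\frac{f(x)+f(y)}2\,\bigl(z(y)-z(x)\bigr),$$ and extend this additively to paths of sides. For a vertex $o$ (the origin) the discrete monomials are the functions on the vertices defined by $$Z^{:0:}:=1,\qquad Z^{:m:}(x):=m\int_{o}^{x} Z^{:m-1:}\,dZ\quad(m\ge 1).$$ A function $f$ on the vertices is extended to $U$ by a continuous function $\widehat f$ that is affine along each side and harmonic inside each face. Let $(\diamondsuit_n)_{n\in\mathbb N}$ be a refining sequence of critical maps of $U$, that is, their side lengths $\delta_n$ tend to $0$ and the angles of all lozenges of all $\diamondsuit_n$ are bounded below by a constant $\eta>0$. Let $o_n$ be a vertex of $\diamondsuit_n$,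 chosen as its origin, such that $o_n$ converges to a point $O\in U$, and let $Z_n^{:m:}$ be the discrete monomials of $\diamondsuit_n$ with origin $o_n$. Then: 1. For every $n$ the graph of vertices and sides of $\diamondsuit_n$ is connected and the integrals that define the $Z_n^{:m:}$ do not depend on the path, so that the discrete monomials are well defined. 2. For every $m\ge 0$ there is a constant $C$ such that for all $n$ $$\bigl|Z_n^{:m:}(x)-(z(x)-z(o_n))^m\bigr|\le C\,\delta_n^2\quad\text{for all vertices } x \text{ of }\diamondsuit_n,$$ and likewise $\bigl|\widehat{Z_n^{:m:}}(p)-(z(p)-z(o_n))^m\bigr|\le C\,\delta_n^2$ for all $p\in U$. In particular, if all $o_n$ are equal to $O$ and $z(O)=0$, the discrete monomials converge to $z^m$ with error $O(\delta_n^2)$. 3. For every $m\ge 0$, $Z_n^{:m:}$ (on the vertices) and $\widehat{Z_n^{:m:}}$ (on $U$) converge uniformly to $(z-z(O))^m$ as $n\to\infty$. -/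

import Mathlib

open Set Filter Topology

/-- `z : U → ℂ` is a flat coordinate (developing map) on `U`: it is continuous and locally
injective.  The flat metric on `U` is the one for which `z` is a local isometry, so lengths and
angles in `U` are read off in `ℂ` through `z`.  The map `z` need not be globally injective. -/
structure IsDevelopingMap {U : Type*} [TopologicalSpace U] (z : U → ℂ) : Prop where
  continuous : Continuous z
  locally_injective : ∀ p : U, ∃ W ∈ 𝓝 p, InjOn z W

/-- A critical map with side length `δ` of a compact surface `U` with flat coordinate `z`:
a finite cellular decomposition of the whole of `U` into lozenges of side `δ`. -/
structure CriticalMap {U : Type*} [TopologicalSpace U] (z : U → ℂ) (δ : ℝ) where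
  /-- the set of faces -/
  Face : Type
  finite_face : Finite Face
  /-- the four corners of a face, in cyclic order (indices are modulo `4`) -/
  corner : Face → Fin 4 → U
  /-- the closed subset of `U` occupied by a face -/
  carrier : Face → Set U
  side_pos : 0 < δ
  corner_mem : ∀ q i, corner q i ∈ carrier q
  isClosed_carrier : ∀ q, IsClosed (carrier q)
  injOn_carrier : ∀ q, InjOn z (carrier q)
  /-- read in the coordinate `z`, a face is the filled quadrilateral spanned by its corners -/
  image_carrier : ∀ q, z '' carrier q = convexHull ℝ (range fun i => z (corner q i))
  /-- opposite sides are parallel -/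
  parallelogram : ∀ q, z (corner q 0) + z (corner q 2) = z (corner q 1) + z (corner q 3)
  /-- all sides have length `δ` -/
  side_length : ∀ q i, dist (z (corner q i)) (z (corner q (i + 1))) = δ
  /-- the lozenges are not flattened -/
  angle_pos : ∀ q i,
    0 < EuclideanGeometry.angle (z (corner q (i - 1))) (z (corner q i)) (z (corner q (i + 1)))
  /-- the faces cover `U` -/
  cover : ⋃ q, carrier q = univ
  /-- two distinct faces are disjoint, or meet exactly in a common vertex, or meet exactly in a
  common side -/
  inter_carrier : ∀ q q', q ≠ q' →
    carrier q ∩ carrier q' = ∅ ∨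
    (∃ i j, corner q i = corner q' j ∧ carrier q ∩ carrier q' = {corner q i}) ∨
    (∃ i j,
      {p ∈ carrier q | z p ∈ segment ℝ (z (corner q i)) (z (corner q (i + 1)))} =
        {p ∈ carrier q' | z p ∈ segment ℝ (z (corner q' j)) (z (corner q' (j + 1)))} ∧
      carrier q ∩ carrier q' =
        {p ∈ carrier q | z p ∈ segment ℝ (z (corner q i)) (z (corner q (i + 1)))})

namespace CriticalMap

variable {U : Type*} [TopologicalSpace U] {z : U → ℂ} {δ : ℝ}

/-- The set of vertices: all corners of all faces. -/
def vertices (M : CriticalMap z δ) : Set U :=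
  {p | ∃ q i, M.corner q i = p}

/-- The corner `i` of the face `q`, as a vertex. -/
def vertex (M : CriticalMap z δ) (q : M.Face) (i : Fin 4) : M.vertices :=
  ⟨M.corner q i, q, i, rfl⟩

/-- The graph formed by the vertices and the sides of the lozenges. -/
def graph (M : CriticalMap z δ) : SimpleGraph M.vertices :=
  SimpleGraph.fromRel fun x y => ∃ q i, M.vertex q i = x ∧ M.vertex q (i + 1) = y

/-- The integral of the discrete `1`-form `f dZ` along a path of edges: the edge from `x` to `y`
contributes `(f x + f y) / 2 * (z y - z x)`. -/
noncomputable def pathIntegral (M : CriticalMap z δ) (f : M.vertices → ℂ) :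
    {x y : M.vertices} → M.graph.Walk x y → ℂ
  | _, _, SimpleGraph.Walk.nil => 0
  | _, _, SimpleGraph.Walk.cons (u := x) (v := y) _ w =>
      (f x + f y) / 2 * (z y - z x) + M.pathIntegral f w

open Classical in
/-- The discrete primitive `x ↦ ∫_o^x f dZ`, computed along some path of edges from `o` to `x`
(and `0` if there is no such path). -/
noncomputable def integral (M : CriticalMap z δ) (o : M.vertices) (f : M.vertices → ℂ)
    (x : M.vertices) : ℂ :=
  if h : M.graph.Reachable o x then M.pathIntegral f h.some else 0

/-- The discrete monomials `Z^{:m:}` with origin `o`: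
`Z^{:0:} = 1` and `Z^{:m+1:} = (m + 1) ∫_o Z^{:m:} dZ`. -/
noncomputable def monomial (M : CriticalMap z δ) (o : M.vertices) : ℕ → M.vertices → ℂ
  | 0 => fun _ => 1
  | m + 1 => fun x => (m + 1 : ℂ) * M.integral o (M.monomial o m) x

/-- `g` is the piecewise harmonic extension to `U` of the function `f` on the vertices: it is
affine along each side, and on each face it is continuous, and harmonic in the interior, as a
function of the coordinate `z`. -/
def IsHarmonicExtension (M : CriticalMap z δ) (f : M.vertices → ℂ) (g : U → ℂ) : Prop :=
  ∀ q, ∃ h : ℂ → ℂ,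
    (∀ p ∈ M.carrier q, g p = h (z p)) ∧
    ContinuousOn h (z '' M.carrier q) ∧
    InnerProductSpace.HarmonicOnNhd h (interior (z '' M.carrier q)) ∧
    ∀ i, ∀ t ∈ Icc (0 : ℝ) 1,
      h (AffineMap.lineMap (z (M.corner q i)) (z (M.corner q (i + 1))) t) =
        AffineMap.lineMap (f (M.vertex q i)) (f (M.vertex q (i + 1))) t

/-- The function `f` on the vertices approximates `F : U → ℂ` uniformly with error at most `ε`,
at all vertices as well as, through its piecewise harmonic extension, at all points of `U`. -/
def ApproxWithin (M : CriticalMap z δ) (f : M.vertices → ℂ) (F : U → ℂ) (ε : ℝ) : Prop :=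
  (∀ x : M.vertices, ‖f x - F x‖ ≤ ε) ∧
    ∀ g : U → ℂ, M.IsHarmonicExtension f g → ∀ p : U, ‖g p - F p‖ ≤ ε

end CriticalMap

/-- A sequence of critical maps of one and the same flat surface is refining if the side lengths
tend to zero and the angles of all lozenges of all maps are bounded away from zero. -/
structure IsRefining {U : Type*} [TopologicalSpace U] {z : U → ℂ} {δ : ℕ → ℝ}
    (M : ∀ n, CriticalMap z (δ n)) : Prop where
  tendsto_side : Tendsto δ atTop (𝓝 0)
  angle_bound : ∃ η > 0, ∀ n (q : (M n).Face) i,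
    η ≤ EuclideanGeometry.angle (z ((M n).corner q (i - 1))) (z ((M n).corner q i))
      (z ((M n).corner q (i + 1)))

/-! On a lozenge the four terms of `f dZ` add up to half the defect of the discrete Cauchy–Riemann
equation, up to sign, so `f dZ` is closed exactly when `f` is discrete holomorphic. As `U` is simply
connected, a closed form has a primitive (`CriticalMap.exists_isPrimitive`, resting on
`exists_primitive`), and this primitive is again discrete holomorphic. By induction every monomial
can be integrated, and the path is irrelevant.

For the error, compare `Z^{:m+1:}` with the power along a path of edges. One edge contributes the
trapezoidal error, of order `δ^3`, plus the error of `Z^{:m:}`, of order `δ^2`, times the edge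
length `δ`. A path of `O(1/δ)` edges therefore accumulates `O(δ^2)`
(`CriticalMap.exists_vertex_error`).

The geometric point is that any two vertices are joined by edge paths with `length * δ` bounded
uniformly in `n` (`IsRefining.exists_walk_bound`). The map `M 0` serves as a fixed finite atlas. Two
points of one of its faces span a segment inside that face, and the fine lozenges meeting this
segment form a chain. The angle bound gives each lozenge a disc of radius comparable to `δ`, and `z`
is injective near the coarse face, so comparing areas leaves only `O(1/δ)` lozenges.

Inside the faces, a harmonic extension minus the holomorphic power is harmonic. By the maximum
principle it is controlled on the sides, where the error of linear interpolation is `O(δ^2)`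
(`CriticalMap.exists_extension_error`). Finally, moving the centre from `z (o n)` to `z O` costs a
Lipschitz term that tends to zero. -/

/-! ### Exactness of closed cochains on a simply connected space -/

/-- A closed additive cochain given on the members of a finite closed cover of a simply connected
space is globally exact. -/
theorem exists_primitive_of_discreteTopology {X ι A : Type*} [TopologicalSpace X]
    [SimplyConnectedSpace X] [Finite ι] [AddCommGroup A] [TopologicalSpace A] [DiscreteTopology A]
    (K : ι → Set X) (hK : ∀ i, IsClosed (K i)) (hcov : ∀ x, ∃ i, x ∈ K i)
    (hpath : ∀ i, ∀ x ∈ K i, ∀ y ∈ K i, JoinedIn (K i) x y)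
    (g : ι → X → A)
    (hg : ∀ i j, ∀ x ∈ K i ∩ K j, ∀ y ∈ K i ∩ K j, g i x - g i y = g j x - g j y) :
    ∃ G : X → A, ∀ i, ∀ x ∈ K i, ∀ y ∈ K i, G x - G y = g i x - g i y := by
  classical
  -- The increment from `p` to `x` read in any member containing both points; the compatibility `hg`
  -- makes the choice irrelevant. The value `0` is only a default.
  let d : X → X → A := fun p x => if h : ∃ i, p ∈ K i ∧ x ∈ K i then
    g h.choose x - g h.choose p else 0
  have hd : ∀ i p x, p ∈ K i → x ∈ K i → d p x = g i x - g i p := by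
    intro i p x hp hx
    have h : ∃ i, p ∈ K i ∧ x ∈ K i := ⟨i, hp, hx⟩
    simp only [d, dif_pos h]
    exact hg _ _ _ ⟨h.choose_spec.2, hx⟩ _ ⟨h.choose_spec.1, hp⟩
  -- The open star of `p`: every member through a point of `N p` also contains `p`, so `d p` is
  -- meaningful on `N p`.
  let N : X → Set X := fun p => {x | ∀ i, x ∈ K i → p ∈ K i}
  have hN : ∀ p, IsOpen (N p) := by
    intro p
    have : N p = ⋂ i ∈ {i | p ∉ K i}, (K i)ᶜ := by
      ext x
      simp only [N, mem_ofPred_eq, mem_iInter, mem_compl_iff]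
      exact forall_congr' fun i => not_imp_not.symm
    rw [this]
    exact (toFinite _).isOpen_biInter fun i _ => (hK i).isOpen_compl
  have hNp : ∀ p, p ∈ N p := fun p i h => h
  have hloc : ∀ p x₀ x, x₀ ∈ N p → x ∈ N p → x ∈ N x₀ → d p x = d x₀ x + d p x₀ := by
    intro p x₀ x _ hx hx0
    obtain ⟨i, hi⟩ := hcov x
    rw [hd i p x (hx i hi) hi, hd i x₀ x (hx0 i hi) hi, hd i p x₀ (hx i hi) (hx0 i hi)]
    abel
  -- The covering space of germs of primitives: the coordinate `c` in the chart of `p` stands for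
  -- the branch `c + d p`, whose value at `x` does not depend on the chart. By `hloc` the transition
  -- functions are locally constant in `x`.
  let Z : FiberBundleCore X X A :=
    { baseSet := N
      isOpen_baseSet := hN
      indexAt := id
      mem_baseSet_at := hNp
      coordChange := fun p q x c => c + d p x - d q x
      coordChange_self := fun p x _ v => by abel
      continuousOn_coordChange := by
        rintro p q ⟨x₀, c₀⟩ ⟨⟨hx₀, hx₀'⟩, -⟩
        apply ContinuousAt.continuousWithinAt
        have : (fun y : X × A => y.2 + d p x₀ - d q x₀) =ᶠ[𝓝 (x₀, c₀)]
            fun y => y.2 + d p y.1 - d q y.1 := by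
          have h : ∀ᶠ x in 𝓝 x₀, x ∈ N p ∧ x ∈ N q ∧ x ∈ N x₀ :=
            inter_mem ((hN p).mem_nhds hx₀)
              (inter_mem ((hN q).mem_nhds hx₀') ((hN x₀).mem_nhds (hNp x₀)))
          filter_upwards [continuous_fst.continuousAt.eventually h] with y ⟨h1, h2, h3⟩
          rw [hloc p x₀ y.1 hx₀ h1 h3, hloc q x₀ y.1 hx₀' h2 h3]
          abel
        refine ContinuousAt.congr ?_ this
        exact ((continuous_of_discreteTopology (f := fun a : A => a + d p x₀ - d q x₀)).comp
          continuous_snd).continuousAt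
      coordChange_comp := fun i j k x _ v => by abel }
  have cov : IsCoveringMap (Bundle.TotalSpace.proj : Z.TotalSpace → X) :=
    FiberBundle.isCoveringMap
  let mk : X → A → Z.TotalSpace := fun x a => ⟨x, a⟩
  -- Trivial monodromy: the projected loop is homotopic to the constant one, so both lifts end at
  -- the same point of the fibre.
  have huniq : ∀ (e f : Z.TotalSpace), Joined e f → e.proj = f.proj → e = f := by
    rintro ⟨x, a⟩ ⟨y, b⟩ ⟨γ⟩ h
    obtain rfl : x = y := h
    have h1 := cov.monodromy_map (Path.Homotopic.Quotient.mk γ)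
    have h2 := cov.monodromy_map (Path.Homotopic.Quotient.mk (Path.refl (⟨x, a⟩ : Z.TotalSpace)))
    rw [show (Path.Homotopic.Quotient.mk γ).map ⟨_, cov.continuous⟩ =
      (Path.Homotopic.Quotient.mk (Path.refl (⟨x, a⟩ : Z.TotalSpace))).map ⟨_, cov.continuous⟩ from
      Subsingleton.elim (α := Path.Homotopic.Quotient x x) _ _] at h1
    exact congrArg Subtype.val (h2.symm.trans h1)
  have hex : ∀ (e : Z.TotalSpace) (x : X), Joined e.proj x → ∃ a : A,
      Joined e (mk x a) := by
    rintro e x ⟨γ⟩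
    obtain ⟨Γ, hΓ, hΓ0⟩ := cov.exists_path_lifts γ e γ.source
    have h1 : (Γ 1).proj = x := (congrFun hΓ 1).trans γ.target
    generalize hf : Γ 1 = f at h1
    obtain ⟨y, b⟩ := f
    obtain rfl : y = x := h1
    exact ⟨b, ⟨⟨Γ, hΓ0, hf⟩⟩⟩
  -- Inside one member, the graph of `g i` plus a constant lifts paths: it is constant in local
  -- charts, hence continuous.
  have hjoin : ∀ i, ∀ x ∈ K i, ∀ y ∈ K i, ∀ a : A,
      Joined (mk x a) (mk y (a + g i y - g i x)) := by
    intro i x hx y hy a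
    obtain ⟨γ, hγ⟩ := hpath i x hx y hy
    have hc : Continuous fun t => (⟨γ t, a + g i (γ t) - g i x⟩ : Z.TotalSpace) := by
      rw [continuous_iff_continuousAt]
      intro t
      rw [FiberBundle.continuousAt_totalSpace A]
      refine ⟨γ.continuous.continuousAt, ?_⟩
      have : (fun _ => a + g i (γ t) - g i x) =ᶠ[𝓝 t]
          fun s => a + g i (γ s) - g i x + d (γ s) (γ s) - d (γ t) (γ s) := by
        have h : ∀ᶠ s in 𝓝 t, γ s ∈ N (γ t) :=
          γ.continuous.continuousAt.eventually ((hN _).mem_nhds (hNp _))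
        filter_upwards [h] with s hs
        rw [hd i (γ s) (γ s) (hγ s) (hγ s), hd i (γ t) (γ s) (hγ t) (hγ s)]
        abel
      exact continuousAt_const.congr this
    have h0 : mk (γ 0) (a + g i (γ 0) - g i x) = mk x a := by
      rw [γ.source, add_sub_cancel_right]
    have h1 : mk (γ 1) (a + g i (γ 1) - g i x) = mk y (a + g i y - g i x) := by
      rw [γ.target]
    exact ⟨⟨⟨_, hc⟩, h0, h1⟩⟩
  obtain ⟨o⟩ := (inferInstance : Nonempty X)
  have hall : ∀ x, ∃ a : A, Joined (mk o 0) (mk x a) := fun x =>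
    hex (mk o 0) x (PathConnectedSpace.joined o x)
  -- The primitive is the sheet through `(o, 0)`.
  choose G hG using hall
  refine ⟨G, fun i x hx y hy => ?_⟩
  have h := huniq _ _ ((hG x).symm.trans ((hG y).trans (hjoin i y hy x hx (G y)))) rfl
  have h' : G x = G y + g i x - g i y :=
    congrArg (fun e : Z.TotalSpace => (e.2 : A)) h
  rw [h']; abel

theorem exists_primitive {X ι A : Type*} [TopologicalSpace X]
    [SimplyConnectedSpace X] [Finite ι] [AddCommGroup A]
    (K : ι → Set X) (hK : ∀ i, IsClosed (K i)) (hcov : ∀ x, ∃ i, x ∈ K i)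
    (hpath : ∀ i, ∀ x ∈ K i, ∀ y ∈ K i, JoinedIn (K i) x y)
    (g : ι → X → A)
    (hg : ∀ i j, ∀ x ∈ K i ∩ K j, ∀ y ∈ K i ∩ K j, g i x - g i y = g j x - g j y) :
    ∃ G : X → A, ∀ i, ∀ x ∈ K i, ∀ y ∈ K i, G x - G y = g i x - g i y := by
  let _ : TopologicalSpace A := ⊥
  have : DiscreteTopology A := ⟨rfl⟩
  exact exists_primitive_of_discreteTopology K hK hcov hpath g hg

/-! ### Maximum principle -/

open InnerProductSpace in
/-- The maximum principle for real harmonic functions on a compact subset of the plane. -/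
theorem harmonic_le_of_frontier_le {K : Set ℂ} (hK : IsCompact K) {u : ℂ → ℝ}
    (hu : ContinuousOn u K) (hh : HarmonicOnNhd u (interior K)) {c : ℝ}
    (hc : ∀ w ∈ frontier K, u w ≤ c) : ∀ w ∈ K, u w ≤ c := by
  intro w hw
  obtain ⟨x₀, hx₀, hmax⟩ := hK.exists_isMaxOn ⟨w, hw⟩ hu
  refine (hmax hw).trans ?_
  by_contra! hlt
  -- If the maximum exceeded `c`, the set where it is attained would avoid the frontier and be
  -- clopen, nonempty and compact in `ℂ`.
  let A : Set ℂ := K ∩ u ⁻¹' {u x₀}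
  have hAK : A ⊆ interior K := by
    rintro x ⟨hx, hux⟩
    by_contra hxi
    have : x ∈ frontier K := ⟨subset_closure hx, hxi⟩
    have := hc x this
    rw [mem_preimage, mem_singleton_iff] at hux
    linarith
  have hAcl : IsClosed A := hu.preimage_isClosed_of_isClosed hK.isClosed isClosed_singleton
  have hAop : IsOpen A := by
    rw [isOpen_iff_mem_nhds]
    intro x hx
    obtain ⟨r, hr, hball⟩ := Metric.isOpen_iff.1 isOpen_interior x (hAK hx)
    -- Openness comes from the holomorphic maximum principle: locally `u = Re F`, and `exp F` has
    -- modulus `exp u`.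
    obtain ⟨F, hF, hFu⟩ := (hh.mono hball).exists_analyticOnNhd_ball_re_eq
    have hev : ∀ᶠ y in 𝓝 x, y ∈ Metric.ball x r := Metric.ball_mem_nhds x hr
    have hdiff : ∀ᶠ y in 𝓝 x, DifferentiableAt ℂ (fun y => Complex.exp (F y)) y := by
      filter_upwards [hev] with y hy
      exact (hF y hy).differentiableAt.cexp
    have hnorm : ∀ y ∈ Metric.ball x r, ‖Complex.exp (F y)‖ = Real.exp (u y) := by
      intro y hy
      rw [Complex.norm_exp, ← hFu hy]
    have hxu : u x = u x₀ := hx.2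
    have hloc : IsLocalMax (norm ∘ fun y => Complex.exp (F y)) x := by
      filter_upwards [hev] with y hy
      simp only [Function.comp]
      rw [hnorm y hy, hnorm x (Metric.mem_ball_self hr), Real.exp_le_exp, hxu]
      exact hmax (interior_subset (hball hy))
    filter_upwards [hev, Complex.norm_eventually_eq_of_isLocalMax hdiff hloc] with y hy hy2
    rw [hnorm y hy, hnorm x (Metric.mem_ball_self hr), Real.exp_eq_exp, hxu] at hy2
    exact ⟨interior_subset (hball hy), hy2⟩
  have huniv : A = univ := IsClopen.eq_univ ⟨hAcl, hAop⟩ ⟨x₀, hx₀, rfl⟩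
  have hAc : IsCompact A := hK.of_isClosed_subset hAcl inter_subset_left
  rw [huniv] at hAc
  exact noncompact_univ ℂ hAc

open InnerProductSpace in
/-- The maximum principle for complex harmonic functions on a compact subset of the plane. -/
theorem norm_harmonic_le_of_frontier_le {K : Set ℂ} (hK : IsCompact K) {h : ℂ → ℂ}
    (hu : ContinuousOn h K) (hh : HarmonicOnNhd h (interior K)) {c : ℝ}
    (hc : ∀ w ∈ frontier K, ‖h w‖ ≤ c) : ∀ w ∈ K, ‖h w‖ ≤ c := by
  intro w hw
  rcases eq_or_ne (h w) 0 with h0 | h0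
  -- No phase is available when `h w = 0`; a frontier point is needed only to see that `0 ≤ c`.
  · obtain ⟨x, hx⟩ : (frontier K).Nonempty := by
      rw [nonempty_iff_ne_empty]
      intro he
      have := (isClopen_iff_frontier_eq_empty.2 he).eq_univ ⟨w, hw⟩
      exact noncompact_univ ℂ (this ▸ hK)
    rw [h0, norm_zero]
    exact (norm_nonneg _).trans (hc x hx)
  -- Rotating by the phase `a` makes `h w` real and positive, which reduces to the real harmonic
  -- function `Re (a * h)`.
  · set a : ℂ := (starRingEnd ℂ) (h w) / ‖h w‖ with ha
    have hna : ‖a‖ = 1 := by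
      rw [ha, norm_div, RCLike.norm_conj, Complex.norm_real, norm_norm]
      exact div_self (norm_ne_zero_iff.2 h0)
    let l : ℂ →L[ℝ] ℝ := Complex.reCLM.comp (ContinuousLinearMap.mul ℝ ℂ a)
    have hl : ∀ y, l y = (a * y).re := fun y => rfl
    have hle : ∀ y, l y ≤ ‖y‖ := fun y => by
      rw [hl]
      refine (Complex.re_le_norm _).trans ?_
      rw [norm_mul, hna, one_mul]
    have hlw : l (h w) = ‖h w‖ := by
      have : a * h w = (‖h w‖ : ℂ) := by
        rw [ha, div_mul_eq_mul_div, mul_comm, Complex.mul_conj, Complex.normSq_eq_norm_sq]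
        have : (‖h w‖ : ℂ) ≠ 0 := by exact_mod_cast norm_ne_zero_iff.2 h0
        push_cast
        field_simp
      rw [hl, this, Complex.ofReal_re]
    rw [← hlw]
    exact harmonic_le_of_frontier_le (u := l ∘ h) hK (l.continuous.comp_continuousOn hu)
      (hh.comp_CLM l) (fun y hy => (hle _).trans (hc y hy)) w hw

/-! ### Plane geometry of parallelograms -/

/-- The signed area of the parallelogram spanned by two plane vectors. -/
def planeCross (a b : ℂ) : ℝ := a.re * b.im - a.im * b.re

theorem abs_planeCross_le (a b : ℂ) : |planeCross a b| ≤ ‖a‖ * ‖b‖ := by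
  have h : planeCross a b = ((starRingEnd ℂ) a * b).im := by
    simp [planeCross]; ring
  rw [h]
  refine (Complex.abs_im_le_norm _).trans ?_
  rw [norm_mul, RCLike.norm_conj]

theorem abs_planeCross_eq (a b : ℂ) :
    |planeCross a b| = Real.sin (InnerProductGeometry.angle a b) * (‖a‖ * ‖b‖) := by
  rw [InnerProductGeometry.sin_angle_mul_norm_mul_norm, ← Real.sqrt_sq_eq_abs]
  congr 1
  simp only [planeCross, Complex.inner, Complex.mul_re, Complex.conj_re, Complex.conj_im]
  ring

/-- First coordinate in the affine frame with origin `w 0` and axes `w 1 - w 0`, `w 3 - w 0`. -/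
noncomputable def frameFst (w : Fin 4 → ℂ) (x : ℂ) : ℝ :=
  planeCross (x - w 0) (w 3 - w 0) / planeCross (w 1 - w 0) (w 3 - w 0)

/-- Second coordinate in the affine frame with origin `w 0` and axes `w 1 - w 0`, `w 3 - w 0`. -/
noncomputable def frameSnd (w : Fin 4 → ℂ) (x : ℂ) : ℝ :=
  planeCross (w 1 - w 0) (x - w 0) / planeCross (w 1 - w 0) (w 3 - w 0)

section Parallelogram

variable {w : Fin 4 → ℂ}

theorem frame_repr (hD : planeCross (w 1 - w 0) (w 3 - w 0) ≠ 0) (x : ℂ) :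
    x = w 0 + frameFst w x * (w 1 - w 0) + frameSnd w x * (w 3 - w 0) := by
  have h : frameFst w x * planeCross (w 1 - w 0) (w 3 - w 0) = planeCross (x - w 0) (w 3 - w 0) :=
    div_mul_cancel₀ _ hD
  have h' : frameSnd w x * planeCross (w 1 - w 0) (w 3 - w 0) = planeCross (w 1 - w 0) (x - w 0) :=
    div_mul_cancel₀ _ hD
  generalize frameFst w x = s at *
  generalize frameSnd w x = t at *
  apply Complex.ext
  · apply mul_right_cancel₀ hD
    simp only [planeCross, Complex.sub_re, Complex.sub_im, Complex.add_re, Complex.mul_re,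
      Complex.ofReal_re, Complex.ofReal_im] at *
    linear_combination (-((w 1).re - (w 0).re)) * h - ((w 3).re - (w 0).re) * h'
  · apply mul_right_cancel₀ hD
    simp only [planeCross, Complex.sub_re, Complex.sub_im, Complex.add_im, Complex.mul_im,
      Complex.ofReal_re, Complex.ofReal_im] at *
    linear_combination (-((w 1).im - (w 0).im)) * h - ((w 3).im - (w 0).im) * h'

theorem frameFst_combo (hD : planeCross (w 1 - w 0) (w 3 - w 0) ≠ 0) (a b : ℝ) :
    frameFst w (w 0 + a * (w 1 - w 0) + b * (w 3 - w 0)) = a := by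
  rw [frameFst, div_eq_iff hD]
  simp only [planeCross, Complex.sub_re, Complex.sub_im, Complex.add_re, Complex.add_im,
    Complex.mul_re, Complex.mul_im, Complex.ofReal_re, Complex.ofReal_im]
  ring

theorem frameSnd_combo (hD : planeCross (w 1 - w 0) (w 3 - w 0) ≠ 0) (a b : ℝ) :
    frameSnd w (w 0 + a * (w 1 - w 0) + b * (w 3 - w 0)) = b := by
  rw [frameSnd, div_eq_iff hD]
  simp only [planeCross, Complex.sub_re, Complex.sub_im, Complex.add_re, Complex.add_im,
    Complex.mul_re, Complex.mul_im, Complex.ofReal_re, Complex.ofReal_im]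
  ring

theorem continuous_frameFst : Continuous (frameFst w) := by
  unfold frameFst planeCross
  exact Continuous.div_const (by fun_prop) _

theorem continuous_frameSnd : Continuous (frameSnd w) := by
  unfold frameSnd planeCross
  exact Continuous.div_const (by fun_prop) _

/-- In the affine frame the parallelogram becomes the unit square. One inclusion is convexity of the
square; for the other, the point is interpolated between points of two opposite sides. -/
theorem mem_parallelogram_iff (hp : w 0 + w 2 = w 1 + w 3)
    (hD : planeCross (w 1 - w 0) (w 3 - w 0) ≠ 0) (x : ℂ) :
    x ∈ convexHull ℝ (range w) ↔ frameFst w x ∈ Icc (0 : ℝ) 1 ∧ frameSnd w x ∈ Icc (0 : ℝ) 1 := by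
  have hw2 : w 2 = w 1 + w 3 - w 0 := by rw [← hp]; ring
  constructor
  · intro hx
    have hS : Convex ℝ {x | frameFst w x ∈ Icc (0 : ℝ) 1 ∧ frameSnd w x ∈ Icc (0 : ℝ) 1} := by
      intro x hx y hy a b ha hb hab
      have h1 : frameFst w (a • x + b • y) = a * frameFst w x + b * frameFst w y := by
        have e : a • x + b • y = w 0 + ((a * frameFst w x + b * frameFst w y : ℝ) : ℂ) *
            (w 1 - w 0) + ((a * frameSnd w x + b * frameSnd w y : ℝ) : ℂ) * (w 3 - w 0) := by
          conv_lhs => rw [frame_repr hD x, frame_repr hD y]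
          have hab' : (a : ℂ) + b = 1 := by exact_mod_cast hab
          simp only [Complex.real_smul]
          push_cast
          linear_combination (w 0) * hab'
        rw [e, frameFst_combo hD]
      have h2 : frameSnd w (a • x + b • y) = a * frameSnd w x + b * frameSnd w y := by
        have e : a • x + b • y = w 0 + ((a * frameFst w x + b * frameFst w y : ℝ) : ℂ) *
            (w 1 - w 0) + ((a * frameSnd w x + b * frameSnd w y : ℝ) : ℂ) * (w 3 - w 0) := by
          conv_lhs => rw [frame_repr hD x, frame_repr hD y]
          have hab' : (a : ℂ) + b = 1 := by exact_mod_cast hab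
          simp only [Complex.real_smul]
          push_cast
          linear_combination (w 0) * hab'
        rw [e, frameSnd_combo hD]
      refine ⟨?_, ?_⟩
      · rw [h1]; exact convex_Icc (0 : ℝ) 1 hx.1 hy.1 ha hb hab
      · rw [h2]; exact convex_Icc (0 : ℝ) 1 hx.2 hy.2 ha hb hab
    refine convexHull_min ?_ hS hx
    have key : ∀ a b : ℝ, a ∈ Icc (0 : ℝ) 1 → b ∈ Icc (0 : ℝ) 1 →
        w 0 + a * (w 1 - w 0) + b * (w 3 - w 0) ∈
          {x | frameFst w x ∈ Icc (0 : ℝ) 1 ∧ frameSnd w x ∈ Icc (0 : ℝ) 1} := by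
      intro a b ha hb
      refine ⟨?_, ?_⟩
      · rw [frameFst_combo hD]; exact ha
      · rw [frameSnd_combo hD]; exact hb
    rintro _ ⟨i, rfl⟩
    fin_cases i
    · have := key 0 0 (by simp) (by simp)
      simpa using this
    · have := key 1 0 (by simp) (by simp)
      simpa using this
    · have := key 1 1 (by simp) (by simp)
      convert this using 1
      simp only [Fin.reduceFinMk, hw2]
      push_cast
      ring
    · have := key 0 1 (by simp) (by simp)
      simpa using this
  · rintro ⟨⟨hs0, hs1⟩, ⟨ht0, ht1⟩⟩
    have hmem : ∀ i, w i ∈ convexHull ℝ (range w) := fun i =>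
      subset_convexHull ℝ _ (mem_range_self i)
    have hc := convex_convexHull ℝ (range w)
    have h1 := hc (hmem 0) (hmem 1) (sub_nonneg.2 hs1) hs0 (by ring)
    have h2 := hc (hmem 3) (hmem 2) (sub_nonneg.2 hs1) hs0 (by ring)
    have h3 := hc h1 h2 (sub_nonneg.2 ht1) ht0 (by ring)
    convert h3 using 1
    conv_lhs => rw [frame_repr hD x]
    simp only [Complex.real_smul, hw2]
    push_cast
    ring

theorem mem_interior_parallelogram (hp : w 0 + w 2 = w 1 + w 3)
    (hD : planeCross (w 1 - w 0) (w 3 - w 0) ≠ 0) {x : ℂ}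
    (h1 : frameFst w x ∈ Ioo (0 : ℝ) 1) (h2 : frameSnd w x ∈ Ioo (0 : ℝ) 1) :
    x ∈ interior (convexHull ℝ (range w)) := by
  rw [mem_interior]
  refine ⟨frameFst w ⁻¹' Ioo 0 1 ∩ frameSnd w ⁻¹' Ioo 0 1, ?_,
    (isOpen_Ioo.preimage continuous_frameFst).inter (isOpen_Ioo.preimage continuous_frameSnd),
    h1, h2⟩
  rintro y ⟨hy1, hy2⟩
  exact (mem_parallelogram_iff hp hD y).2 ⟨Ioo_subset_Icc_self hy1, Ioo_subset_Icc_self hy2⟩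

/-- Coordinates of the point `τ` on the side `i`. -/
theorem frame_lineMap (hp : w 0 + w 2 = w 1 + w 3)
    (hD : planeCross (w 1 - w 0) (w 3 - w 0) ≠ 0) (i : Fin 4) (τ : ℝ) :
    (frameFst w (AffineMap.lineMap (w i) (w (i + 1)) τ),
      frameSnd w (AffineMap.lineMap (w i) (w (i + 1)) τ)) =
    (![(τ, 0), (1, τ), (1 - τ, 1), (0, 1 - τ)] : Fin 4 → ℝ × ℝ) i := by
  have hw2 : w 2 = w 1 + w 3 - w 0 := by rw [← hp]; ring
  have key : ∀ (x : ℂ) (a b : ℝ), x = w 0 + a * (w 1 - w 0) + b * (w 3 - w 0) →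
      (frameFst w x, frameSnd w x) = (a, b) := by
    rintro x a b rfl
    rw [frameFst_combo hD, frameSnd_combo hD]
  fin_cases i <;> refine key _ _ _ ?_ <;>
    simp [AffineMap.lineMap_apply, hw2] <;> ring

theorem mem_side_of_frame (hp : w 0 + w 2 = w 1 + w 3)
    (hD : planeCross (w 1 - w 0) (w 3 - w 0) ≠ 0) {x : ℂ}
    (h1 : frameFst w x ∈ Icc (0 : ℝ) 1) (h2 : frameSnd w x ∈ Icc (0 : ℝ) 1)
    (h : ¬ (frameFst w x ∈ Ioo (0 : ℝ) 1 ∧ frameSnd w x ∈ Ioo (0 : ℝ) 1)) :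
    ∃ i, ∃ τ ∈ Icc (0 : ℝ) 1, x = AffineMap.lineMap (w i) (w (i + 1)) τ := by
  have hw2 : w 2 = w 1 + w 3 - w 0 := by rw [← hp]; ring
  have hx := frame_repr hD x
  generalize frameFst w x = s at *
  generalize frameSnd w x = t at *
  obtain ⟨hs0, hs1⟩ := h1
  obtain ⟨ht0, ht1⟩ := h2
  have : s = 0 ∨ s = 1 ∨ t = 0 ∨ t = 1 := by
    by_contra! hne
    exact h ⟨⟨hs0.lt_of_ne' hne.1, hs1.lt_of_ne hne.2.1⟩, ht0.lt_of_ne' hne.2.2.1,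
      ht1.lt_of_ne hne.2.2.2⟩
  rcases this with rfl | rfl | rfl | rfl
  · refine ⟨3, 1 - t, ⟨by linarith, by linarith⟩, ?_⟩
    rw [hx]; simp [AffineMap.lineMap_apply]; ring
  · refine ⟨1, t, ⟨ht0, ht1⟩, ?_⟩
    rw [hx]; simp [AffineMap.lineMap_apply, hw2]; ring
  · refine ⟨0, s, ⟨hs0, hs1⟩, ?_⟩
    rw [hx]; simp [AffineMap.lineMap_apply]; ring
  · refine ⟨2, 1 - s, ⟨by linarith, by linarith⟩, ?_⟩
    rw [hx]; simp [AffineMap.lineMap_apply, hw2]; ring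

theorem frontier_parallelogram_subset (hp : w 0 + w 2 = w 1 + w 3)
    (hD : planeCross (w 1 - w 0) (w 3 - w 0) ≠ 0) {x : ℂ}
    (hx : x ∈ frontier (convexHull ℝ (range w))) :
    ∃ i, ∃ τ ∈ Icc (0 : ℝ) 1, x = AffineMap.lineMap (w i) (w (i + 1)) τ := by
  have hcl : IsClosed (convexHull ℝ (range w)) := ((finite_range w).isCompact_convexHull ℝ).isClosed
  have hx' : x ∈ convexHull ℝ (range w) := hcl.frontier_subset hx
  obtain ⟨h1, h2⟩ := (mem_parallelogram_iff hp hD x).1 hx'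
  exact mem_side_of_frame hp hD h1 h2 fun h => hx.2 (mem_interior_parallelogram hp hD h.1 h.2)

/-- The bilinear interpolation of four values at the corners of a parallelogram. -/
noncomputable def bilinearInterp (w f : Fin 4 → ℂ) (x : ℂ) : ℂ :=
  (1 - frameFst w x) * (1 - frameSnd w x) * f 0 + frameFst w x * (1 - frameSnd w x) * f 1 +
    frameFst w x * frameSnd w x * f 2 + (1 - frameFst w x) * frameSnd w x * f 3

/-- Being affine along each side, the interpolation depends there only on the two end values; this
lets data on neighbouring faces be glued. -/
theorem bilinearInterp_lineMap (hp : w 0 + w 2 = w 1 + w 3)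
    (hD : planeCross (w 1 - w 0) (w 3 - w 0) ≠ 0) (f : Fin 4 → ℂ) (i : Fin 4) (τ : ℝ) :
    bilinearInterp w f (AffineMap.lineMap (w i) (w (i + 1)) τ) =
      AffineMap.lineMap (f i) (f (i + 1)) τ := by
  have h := frame_lineMap hp hD i τ
  rw [Prod.ext_iff] at h
  obtain ⟨h1, h2⟩ := h
  dsimp only at h1 h2
  rw [bilinearInterp, h1, h2]
  fin_cases i <;> simp [AffineMap.lineMap_apply] <;> ring

/-- A ball around the centre of a parallelogram avoids the sides. -/
theorem frame_mem_Ioo_of_mem_ball (hp : w 0 + w 2 = w 1 + w 3)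
    (hD : planeCross (w 1 - w 0) (w 3 - w 0) ≠ 0) {δ r : ℝ} (hδ : 0 < δ)
    (hu : ‖w 1 - w 0‖ = δ) (hv : ‖w 3 - w 0‖ = δ)
    (hr : 2 * (r * δ) ≤ |planeCross (w 1 - w 0) (w 3 - w 0)|) {x : ℂ}
    (hx : x ∈ Metric.ball ((w 0 + w 2) / 2) r) :
    frameFst w x ∈ Ioo (0 : ℝ) 1 ∧ frameSnd w x ∈ Ioo (0 : ℝ) 1 := by
  have hDpos := abs_pos.2 hD
  rw [mem_ball_iff_norm] at hx
  set e := x - (w 0 + w 2) / 2 with he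
  have hw2 : w 2 = w 1 + w 3 - w 0 := by rw [← hp]; ring
  have hx' : x = e + (w 1 + w 3) / 2 := by rw [he, hw2]; ring
  have aux : ∀ c : ℝ, |c| ≤ ‖e‖ * δ →
      1 / 2 + c / planeCross (w 1 - w 0) (w 3 - w 0) ∈ Ioo (0 : ℝ) 1 := by
    intro c hc
    have : |c / planeCross (w 1 - w 0) (w 3 - w 0)| < 1 / 2 := by
      rw [abs_div, div_lt_iff₀ hDpos]
      nlinarith
    obtain ⟨h1, h2⟩ := abs_lt.1 this
    constructor <;> linarith
  constructor
  · have h : frameFst w x = 1 / 2 + planeCross e (w 3 - w 0) /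
        planeCross (w 1 - w 0) (w 3 - w 0) := by
      rw [frameFst, div_eq_iff hD, add_mul, div_mul_cancel₀ _ hD, hx']
      simp [planeCross]; ring
    rw [h]
    apply aux
    rw [← hv]
    exact abs_planeCross_le _ _
  · have h : frameSnd w x = 1 / 2 + planeCross (w 1 - w 0) e /
        planeCross (w 1 - w 0) (w 3 - w 0) := by
      rw [frameSnd, div_eq_iff hD, add_mul, div_mul_cancel₀ _ hD, hx']
      simp [planeCross]; ring
    rw [h]
    apply aux
    rw [← hu, mul_comm]
    exact abs_planeCross_le _ _

/-- If all angles of a rhombus are at least `η`, its area is at least `δ² sin η`. -/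
theorem le_abs_planeCross (hp : w 0 + w 2 = w 1 + w 3) {δ η : ℝ} (hη : 0 ≤ η)
    (hside : ∀ i, dist (w i) (w (i + 1)) = δ)
    (hang : ∀ i, η ≤ EuclideanGeometry.angle (w (i - 1)) (w i) (w (i + 1))) :
    δ ^ 2 * Real.sin η ≤ |planeCross (w 1 - w 0) (w 3 - w 0)| := by
  have hu : ‖w 1 - w 0‖ = δ := by
    have := hside 0
    rwa [zero_add, dist_comm, dist_eq_norm] at this
  have hv : ‖w 3 - w 0‖ = δ := by
    have := hside 3
    rwa [show (3 : Fin 4) + 1 = 0 from rfl, dist_eq_norm] at this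
  have h0 := hang 0
  have h1 := hang 1
  simp only [EuclideanGeometry.angle, vsub_eq_sub] at h0 h1
  rw [show (0 : Fin 4) - 1 = 3 from rfl, zero_add, InnerProductGeometry.angle_comm] at h0
  rw [show (1 : Fin 4) - 1 = 0 from rfl, show (1 : Fin 4) + 1 = 2 from rfl,
    show w 2 - w 1 = w 3 - w 0 by linear_combination hp, ← neg_sub (w 1) (w 0),
    InnerProductGeometry.angle_neg_left] at h1
  rw [abs_planeCross_eq, hu, hv]
  -- Angles at adjacent corners are supplementary, so `η ≤ θ ≤ π - η`.
  have hs : Real.sin η ≤ Real.sin (InnerProductGeometry.angle (w 1 - w 0) (w 3 - w 0)) := by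
    generalize InnerProductGeometry.angle (w 1 - w 0) (w 3 - w 0) = θ at *
    rcases le_total θ (Real.pi / 2) with h | h
    · exact Real.sin_le_sin_of_le_of_le_pi_div_two (by linarith [Real.pi_pos]) h h0
    · rw [← Real.sin_pi_sub θ]
      exact Real.sin_le_sin_of_le_of_le_pi_div_two (by linarith [Real.pi_pos]) (by linarith) h1
  nlinarith [sq_nonneg δ]

end Parallelogram

/-! ### Taylor estimates for powers -/

/-- Taylor expansion of `(a + h) ^ m` to first order, with continuous remainder. -/
theorem exists_taylor_one (m : ℕ) : ∃ P : ℂ × ℂ → ℂ, Continuous P ∧ ∀ a h : ℂ,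
    (a + h) ^ m = a ^ m + m * a ^ (m - 1) * h + h ^ 2 * P (a, h) := by
  induction m with
  | zero => exact ⟨fun _ => 0, continuous_const, fun a h => by simp⟩
  | succ m ih =>
    obtain ⟨P, hP, h⟩ := ih
    refine ⟨fun p => m * p.1 ^ (m - 1) + (p.1 + p.2) * P p, by fun_prop, fun a k => ?_⟩
    -- The truncated exponent `m - 1` is harmless at `m = 0`, where the factor `m` vanishes.
    have : (m : ℂ) * a ^ m = m * a ^ (m - 1) * a := by
      cases m with
      | zero => simp
      | succ m => simp [pow_succ]; ring
    rw [pow_succ, h a k, Nat.add_sub_cancel]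
    push_cast
    linear_combination (-k) * this

/-- Taylor expansion of `(a + h) ^ (m + 1)` to second order, with continuous remainder. -/
theorem exists_taylor_two (m : ℕ) : ∃ P : ℂ × ℂ → ℂ, Continuous P ∧ ∀ a h : ℂ,
    (a + h) ^ (m + 1) = a ^ (m + 1) + (m + 1) * a ^ m * h +
      (m + 1) * (m * a ^ (m - 1)) / 2 * h ^ 2 + h ^ 3 * P (a, h) := by
  induction m with
  | zero => exact ⟨fun _ => 0, continuous_const, fun a h => by simp⟩
  | succ m ih =>
    obtain ⟨P, hP, h⟩ := ih
    refine ⟨fun p => (m + 1) * (m * p.1 ^ (m - 1)) / 2 + (p.1 + p.2) * P p, by fun_prop,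
      fun a k => ?_⟩
    have : (m : ℂ) * a ^ m = m * a ^ (m - 1) * a := by
      cases m with
      | zero => simp
      | succ m => simp [pow_succ]; ring
    rw [pow_succ, h a k, Nat.add_sub_cancel]
    push_cast
    linear_combination (-(m + 1) / 2 * k ^ 2) * this

theorem exists_bound_of_continuous (P : ℂ × ℂ → ℂ) (hP : Continuous P) (R : ℝ) :
    ∃ C : ℝ, 0 ≤ C ∧ ∀ a h : ℂ, ‖a‖ ≤ R → ‖h‖ ≤ R → ‖P (a, h)‖ ≤ C := by
  obtain ⟨C, hC⟩ := (isCompact_closedBall (0 : ℂ × ℂ) R).exists_bound_of_continuousOn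
    hP.continuousOn
  refine ⟨max C 0, le_max_right _ _, fun a h ha hh => (hC (a, h) ?_).trans (le_max_left _ _)⟩
  rw [mem_closedBall_zero_iff, Prod.norm_def]
  exact max_le ha hh

/-- The error of the trapezoidal rule for monomials is of third order. -/
theorem exists_trapezoid_bound (m : ℕ) (R : ℝ) : ∃ C : ℝ, 0 ≤ C ∧ ∀ a h : ℂ, ‖a‖ ≤ R → ‖h‖ ≤ R →
    ‖(m + 1) * ((a ^ m + (a + h) ^ m) / 2 * h) - ((a + h) ^ (m + 1) - a ^ (m + 1))‖ ≤
      C * ‖h‖ ^ 3 := by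
  obtain ⟨P, hP, hP'⟩ := exists_taylor_one m
  obtain ⟨Q, hQ, hQ'⟩ := exists_taylor_two m
  obtain ⟨C, hC0, hC⟩ := exists_bound_of_continuous (fun p => (m + 1) * P p / 2 - Q p)
    (by fun_prop) R
  refine ⟨C, hC0, fun a h ha hh => ?_⟩
  -- The linear and quadratic terms in `h` cancel; this gain of one order over a one-point rule
  -- produces the final `δ ^ 2`.
  have : (m + 1) * ((a ^ m + (a + h) ^ m) / 2 * h) - ((a + h) ^ (m + 1) - a ^ (m + 1)) =
      ((m + 1) * P (a, h) / 2 - Q (a, h)) * h ^ 3 := by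
    rw [hP', hQ']; ring
  rw [this, norm_mul, norm_pow]
  exact mul_le_mul_of_nonneg_right (hC a h ha hh) (by positivity)

/-- The error of linear interpolation for monomials is of second order. -/
theorem exists_interpolation_bound (m : ℕ) (R : ℝ) : ∃ C : ℝ, 0 ≤ C ∧ ∀ a h : ℂ, ‖a‖ ≤ R →
    ‖h‖ ≤ R → ∀ t ∈ Icc (0 : ℝ) 1,
      ‖AffineMap.lineMap (a ^ m) ((a + h) ^ m) t - (a + t * h) ^ m‖ ≤ C * ‖h‖ ^ 2 := by
  obtain ⟨P, hP, hP'⟩ := exists_taylor_one m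
  obtain ⟨C, hC0, hC⟩ := exists_bound_of_continuous P hP R
  refine ⟨2 * C, by positivity, fun a h ha hh t ht => ?_⟩
  have : AffineMap.lineMap (a ^ m) ((a + h) ^ m) t - (a + t * h) ^ m =
      h ^ 2 * (t * P (a, h) - t ^ 2 * P (a, t * h)) := by
    rw [AffineMap.lineMap_apply, hP' a h, hP' a (t * h)]
    simp only [vsub_eq_sub, vadd_eq_add, Complex.real_smul]
    ring
  have hnt : ‖(t : ℂ)‖ ≤ 1 := by
    rw [Complex.norm_real, Real.norm_eq_abs, abs_of_nonneg ht.1]; exact ht.2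
  have hth : ‖(t : ℂ) * h‖ ≤ R := by
    rw [norm_mul]
    exact (mul_le_of_le_one_left (norm_nonneg _) hnt).trans hh
  rw [this, norm_mul, norm_pow, mul_comm]
  refine mul_le_mul_of_nonneg_right ?_ (by positivity)
  refine (norm_sub_le _ _).trans ?_
  rw [norm_mul, norm_mul, norm_pow, two_mul]
  exact add_le_add
    ((mul_le_of_le_one_left (norm_nonneg _) hnt).trans (hC a h ha hh))
    ((mul_le_of_le_one_left (norm_nonneg _) (pow_le_one₀ (norm_nonneg _) hnt)).trans
      (hC a _ ha hth))

/-! ### Discrete holomorphic functions and their primitives -/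

namespace CriticalMap

variable {U : Type*} [TopologicalSpace U] {z : U → ℂ} {δ : ℝ}

/-- The corners of a face, read in the flat coordinate. -/
def pts (M : CriticalMap z δ) (q : M.Face) (i : Fin 4) : ℂ := z (M.corner q i)

theorem planeCross_ne_zero (M : CriticalMap z δ) (q : M.Face) :
    planeCross (M.pts q 1 - M.pts q 0) (M.pts q 3 - M.pts q 0) ≠ 0 := by
  obtain ⟨i₀, hi₀⟩ := Finite.exists_min fun i => EuclideanGeometry.angle (z (M.corner q (i - 1)))
    (z (M.corner q i)) (z (M.corner q (i + 1)))
  have hpos := M.angle_pos q i₀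
  set η := EuclideanGeometry.angle (z (M.corner q (i₀ - 1)))
    (z (M.corner q i₀)) (z (M.corner q (i₀ + 1)))
  -- The smallest of the four angles is capped at `π / 2` to guarantee a positive sine.
  have hm : 0 < min η (Real.pi / 2) := lt_min hpos (by linarith [Real.pi_pos])
  have h := le_abs_planeCross (w := M.pts q) (M.parallelogram q) hm.le (M.side_length q)
    fun i => (min_le_left _ _).trans (hi₀ i)
  have hsin : 0 < Real.sin (min η (Real.pi / 2)) :=
    Real.sin_pos_of_pos_of_lt_pi hm ((min_le_right _ _).trans_lt (by linarith [Real.pi_pos]))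
  have hδ := M.side_pos
  exact abs_pos.1 (lt_of_lt_of_le (by positivity) h)

theorem image_carrier_eq (M : CriticalMap z δ) (q : M.Face) :
    z '' M.carrier q = convexHull ℝ (range (M.pts q)) := M.image_carrier q

/-- Closed subsets of a face are compact, so their images under `z` are closed; an injective closed
map has a continuous inverse on its image. -/
theorem exists_local_inverse [CompactSpace U] (hz : Continuous z) (M : CriticalMap z δ)
    (q : M.Face) : ∃ σ : ℂ → U, ContinuousOn σ (z '' M.carrier q) ∧
      ∀ p ∈ M.carrier q, σ (z p) = p := by
  have hne : Nonempty U := ⟨M.corner q 0⟩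
  have hinv := (M.injOn_carrier q).leftInvOn_invFunOn
  refine ⟨Function.invFunOn z (M.carrier q), ?_, hinv⟩
  rw [continuousOn_iff_isClosed]
  intro t ht
  refine ⟨z '' (t ∩ M.carrier q),
    ((ht.inter (M.isClosed_carrier q)).isCompact.image hz).isClosed, ?_⟩
  ext x
  constructor
  · rintro ⟨hx, p, hp, rfl⟩
    rw [mem_preimage, hinv hp] at hx
    exact ⟨⟨p, ⟨hx, hp⟩, rfl⟩, p, hp, rfl⟩
  · rintro ⟨⟨p, ⟨hpt, hp⟩, rfl⟩, -⟩
    refine ⟨?_, p, hp, rfl⟩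
    rwa [mem_preimage, hinv hp]

theorem convex_image_carrier (M : CriticalMap z δ) (q : M.Face) : Convex ℝ (z '' M.carrier q) := by
  rw [M.image_carrier q]; exact convex_convexHull ℝ _

theorem joinedIn_carrier [CompactSpace U] (hz : Continuous z) (M : CriticalMap z δ) (q : M.Face)
    {x y : U} (hx : x ∈ M.carrier q) (hy : y ∈ M.carrier q) : JoinedIn (M.carrier q) x y := by
  obtain ⟨σ, hσ, hinv⟩ := M.exists_local_inverse hz q
  have hseg : ∀ t ∈ Icc (0 : ℝ) 1, AffineMap.lineMap (z x) (z y) t ∈ z '' M.carrier q :=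
    fun t ht => (M.convex_image_carrier q).segment_subset ⟨x, hx, rfl⟩ ⟨y, hy, rfl⟩
      (by rw [segment_eq_image_lineMap]; exact ⟨t, ht, rfl⟩)
  refine JoinedIn.ofLine (f := fun t => σ (AffineMap.lineMap (z x) (z y) t)) ?_ ?_ ?_ ?_
  · exact hσ.comp (AffineMap.lineMap_continuous.continuousOn) hseg
  · simp [hinv x hx]
  · simp [hinv y hy]
  · rintro _ ⟨t, ht, rfl⟩
    obtain ⟨p, hp, hpt⟩ := hseg t ht
    dsimp only
    rw [← hpt, hinv p hp]
    exact hp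

/-- Inside a face, any two points are joined by a connected set lying over a segment. -/
theorem exists_isPreconnected_segment [CompactSpace U] (hz : Continuous z) (M : CriticalMap z δ)
    (q : M.Face) {x y : U} (hx : x ∈ M.carrier q) (hy : y ∈ M.carrier q) :
    ∃ S ⊆ M.carrier q, IsPreconnected S ∧ x ∈ S ∧ y ∈ S ∧ z '' S ⊆ segment ℝ (z x) (z y) := by
  obtain ⟨σ, hσ, hinv⟩ := M.exists_local_inverse hz q
  have hseg : segment ℝ (z x) (z y) ⊆ z '' M.carrier q :=
    (M.convex_image_carrier q).segment_subset ⟨x, hx, rfl⟩ ⟨y, hy, rfl⟩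
  refine ⟨σ '' segment ℝ (z x) (z y), ?_,
    ((convex_segment (𝕜 := ℝ) (z x) (z y)).isPreconnected).image σ (hσ.mono hseg),
    ⟨z x, left_mem_segment ℝ _ _, hinv x hx⟩, ⟨z y, right_mem_segment ℝ _ _, hinv y hy⟩, ?_⟩
  · rintro _ ⟨w, hw, rfl⟩
    obtain ⟨p, hp, rfl⟩ := hseg hw
    rw [hinv p hp]; exact hp
  · rintro _ ⟨_, ⟨w, hw, rfl⟩, rfl⟩
    obtain ⟨p, hp, rfl⟩ := hseg hw
    rwa [hinv p hp]

/-- Both ends of one side lie on the other side at distance `δ`, its full length, so they are its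
two ends, in one of the two orders. -/
theorem corners_match (M : CriticalMap z δ) {q q' : M.Face} {i j : Fin 4}
    (h : {p ∈ M.carrier q | z p ∈ segment ℝ (z (M.corner q i)) (z (M.corner q (i + 1)))} =
        {p ∈ M.carrier q' | z p ∈ segment ℝ (z (M.corner q' j)) (z (M.corner q' (j + 1)))}) :
    (M.corner q i = M.corner q' j ∧ M.corner q (i + 1) = M.corner q' (j + 1)) ∨
      (M.corner q i = M.corner q' (j + 1) ∧ M.corner q (i + 1) = M.corner q' j) := by
  have h1 : M.corner q i ∈
      {p ∈ M.carrier q | z p ∈ segment ℝ (z (M.corner q i)) (z (M.corner q (i + 1)))} :=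
    ⟨M.corner_mem q i, left_mem_segment ℝ _ _⟩
  have h2 : M.corner q (i + 1) ∈
      {p ∈ M.carrier q | z p ∈ segment ℝ (z (M.corner q i)) (z (M.corner q (i + 1)))} :=
    ⟨M.corner_mem q _, right_mem_segment ℝ _ _⟩
  rw [h] at h1 h2
  obtain ⟨hm1, hs1⟩ := h1
  obtain ⟨hm2, hs2⟩ := h2
  rw [segment_eq_image_lineMap] at hs1 hs2
  obtain ⟨a, ⟨ha0, ha1⟩, ha⟩ := hs1
  obtain ⟨b, ⟨hb0, hb1⟩, hb⟩ := hs2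
  have hd := M.side_length q i
  rw [← ha, ← hb, dist_lineMap_lineMap, M.side_length q' j] at hd
  have hab : dist a b = 1 := (mul_eq_right₀ M.side_pos.ne').1 hd
  rw [Real.dist_eq] at hab
  have hinj := M.injOn_carrier q'
  rcases (abs_eq zero_le_one).1 hab with hab | hab
  · obtain rfl : a = 1 := by linarith
    obtain rfl : b = 0 := by linarith
    rw [AffineMap.lineMap_apply_one] at ha
    rw [AffineMap.lineMap_apply_zero] at hb
    exact Or.inr ⟨hinj hm1 (M.corner_mem _ _) ha.symm, hinj hm2 (M.corner_mem _ _) hb.symm⟩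
  · obtain rfl : a = 0 := by linarith
    obtain rfl : b = 1 := by linarith
    rw [AffineMap.lineMap_apply_zero] at ha
    rw [AffineMap.lineMap_apply_one] at hb
    exact Or.inl ⟨hinj hm1 (M.corner_mem _ _) ha.symm, hinj hm2 (M.corner_mem _ _) hb.symm⟩

theorem exists_common_corner (M : CriticalMap z δ) {q q' : M.Face}
    (h : (M.carrier q ∩ M.carrier q').Nonempty) : ∃ i j, M.vertex q i = M.vertex q' j := by
  by_cases hq : q = q'
  · subst hq; exact ⟨0, 0, rfl⟩
  · rcases M.inter_carrier q q' hq with h0 | ⟨i, j, hij, -⟩ | ⟨i, j, hs, -⟩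
    · exact absurd h0 h.ne_empty
    · exact ⟨i, j, Subtype.ext hij⟩
    · rcases M.corners_match hs with ⟨h1, -⟩ | ⟨h1, -⟩
      · exact ⟨i, j, Subtype.ext h1⟩
      · exact ⟨i, j + 1, Subtype.ext h1⟩

/-- The contribution of an edge to the integral of `f dZ`. -/
noncomputable def edgeIntegral (M : CriticalMap z δ) (f : M.vertices → ℂ) (x y : M.vertices) : ℂ :=
  (f x + f y) / 2 * (z y - z x)

theorem edgeIntegral_symm (M : CriticalMap z δ) (f : M.vertices → ℂ) (x y : M.vertices) :
    M.edgeIntegral f x y = -M.edgeIntegral f y x := by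
  simp only [edgeIntegral]; ring

/-- The discrete Cauchy–Riemann equation on every face. -/
def IsDiscreteHolomorphic (M : CriticalMap z δ) (f : M.vertices → ℂ) : Prop :=
  ∀ q, (f (M.vertex q 2) - f (M.vertex q 0)) * (z (M.corner q 3) - z (M.corner q 1)) =
    (f (M.vertex q 3) - f (M.vertex q 1)) * (z (M.corner q 2) - z (M.corner q 0))

/-- `G` is a primitive of the discrete one-form `f dZ`. -/
def IsPrimitive (M : CriticalMap z δ) (f G : M.vertices → ℂ) : Prop :=
  ∀ q i, G (M.vertex q (i + 1)) - G (M.vertex q i) =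
    M.edgeIntegral f (M.vertex q i) (M.vertex q (i + 1))

/-- Edge integrals give a potential at the corners of each face. Interpolated bilinearly, it becomes
a function on the face whose increments agree on common sides, so `exists_primitive` applies to the
cover by faces. -/
theorem exists_isPrimitive [CompactSpace U] [SimplyConnectedSpace U] (hz : Continuous z)
    (M : CriticalMap z δ) {f : M.vertices → ℂ} (hf : M.IsDiscreteHolomorphic f) :
    ∃ G, M.IsPrimitive f G := by
  have := M.finite_face
  have hΦ : ∀ q, ∃ Φ : Fin 4 → ℂ, ∀ i, Φ (i + 1) - Φ i =
      M.edgeIntegral f (M.vertex q i) (M.vertex q (i + 1)) := by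
    intro q
    refine ⟨![0, M.edgeIntegral f (M.vertex q 0) (M.vertex q 1),
      M.edgeIntegral f (M.vertex q 0) (M.vertex q 1) +
        M.edgeIntegral f (M.vertex q 1) (M.vertex q 2),
      -M.edgeIntegral f (M.vertex q 3) (M.vertex q 0)], fun i => ?_⟩
    have hp := M.parallelogram q
    have hfq := hf q
    fin_cases i
    · simp
    · simp
    -- The other three sides hold by the choice of the potential; closing up along this one is the
    -- discrete Cauchy–Riemann equation.
    · simp only [edgeIntegral, Fin.reduceFinMk, Fin.reduceAdd, Matrix.cons_val]
      simp only [vertex] at *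
      have h2 : z (M.corner q 2) = z (M.corner q 1) + z (M.corner q 3) - z (M.corner q 0) := by
        linear_combination hp
      rw [h2] at hfq ⊢
      linear_combination -hfq / 2
    · simp
  choose Φ hΦ using hΦ
  obtain ⟨G, hG⟩ := exists_primitive M.carrier M.isClosed_carrier
    (fun x => by simpa using (eq_univ_iff_forall.1 M.cover x))
    (fun q x hx y hy => M.joinedIn_carrier hz q hx hy)
    (fun q x => bilinearInterp (M.pts q) (Φ q) (z x)) (by
      intro q q' x hx y hy
      by_cases hq : q = q'
      · rw [hq]
      rcases M.inter_carrier q q' hq with h0 | ⟨i, j, hij, h1⟩ | ⟨i, j, hs, h1⟩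
      · rw [h0] at hx; exact hx.elim
      · rw [h1] at hx hy
        rw [mem_singleton_iff.1 hx, mem_singleton_iff.1 hy, sub_self, sub_self]
      · rw [h1] at hx hy
        have hx2 := hx.2
        have hy2 := hy.2
        rw [segment_eq_image_lineMap] at hx2 hy2
        obtain ⟨a, -, ha⟩ := hx2
        obtain ⟨b, -, hb⟩ := hy2
        have hL : ∀ c : ℝ, bilinearInterp (M.pts q) (Φ q)
            (AffineMap.lineMap (z (M.corner q i)) (z (M.corner q (i + 1))) c) =
            AffineMap.lineMap (Φ q i) (Φ q (i + 1)) c :=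
          bilinearInterp_lineMap (M.parallelogram q) (M.planeCross_ne_zero q) (Φ q) i
        have hL' : ∀ c : ℝ, bilinearInterp (M.pts q') (Φ q')
            (AffineMap.lineMap (z (M.corner q' j)) (z (M.corner q' (j + 1))) c) =
            AffineMap.lineMap (Φ q' j) (Φ q' (j + 1)) c :=
          bilinearInterp_lineMap (M.parallelogram q') (M.planeCross_ne_zero q') (Φ q') j
        have e1 := hΦ q i
        have e2 := hΦ q' j
        rw [← ha, ← hb, hL, hL]
        -- The increments along a common side come from the same edge integral, read in the same or
        -- in the opposite direction.
        rcases M.corners_match hs with ⟨c1, c2⟩ | ⟨c1, c2⟩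
        · have v1 : M.vertex q i = M.vertex q' j := Subtype.ext c1
          have v2 : M.vertex q (i + 1) = M.vertex q' (j + 1) := Subtype.ext c2
          rw [c1, c2, hL', hL']
          rw [v1, v2, ← e2] at e1
          simp only [AffineMap.lineMap_apply, vsub_eq_sub, vadd_eq_add, Complex.real_smul]
          linear_combination ((a : ℂ) - b) * e1
        · have v1 : M.vertex q i = M.vertex q' (j + 1) := Subtype.ext c1
          have v2 : M.vertex q (i + 1) = M.vertex q' j := Subtype.ext c2
          rw [c1, c2, ← AffineMap.lineMap_apply_one_sub (z (M.corner q' j)),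
            ← AffineMap.lineMap_apply_one_sub (z (M.corner q' j)), hL', hL']
          rw [v1, v2, edgeIntegral_symm, ← e2] at e1
          simp only [AffineMap.lineMap_apply, vsub_eq_sub, vadd_eq_add, Complex.real_smul]
          push_cast
          linear_combination ((a : ℂ) - b) * e1)
  refine ⟨fun x => G x, fun q i => ?_⟩
  have h := hG q (M.corner q (i + 1)) (M.corner_mem _ _) (M.corner q i) (M.corner_mem _ _)
  have hL : ∀ c : ℝ, bilinearInterp (M.pts q) (Φ q)
      (AffineMap.lineMap (z (M.corner q i)) (z (M.corner q (i + 1))) c) =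
      AffineMap.lineMap (Φ q i) (Φ q (i + 1)) c :=
    bilinearInterp_lineMap (M.parallelogram q) (M.planeCross_ne_zero q) (Φ q) i
  have h0 := hL 0
  have h1 := hL 1
  rw [AffineMap.lineMap_apply_zero, AffineMap.lineMap_apply_zero] at h0
  rw [AffineMap.lineMap_apply_one, AffineMap.lineMap_apply_one] at h1
  rw [h0, h1, hΦ] at h
  exact h

/-- Expanding the diagonal increments of `G` by the trapezoidal rule, its Cauchy–Riemann defect is
that of `f` times half a side, up to sign. -/
theorem IsPrimitive.isDiscreteHolomorphic (M : CriticalMap z δ) {f G : M.vertices → ℂ}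
    (hf : M.IsDiscreteHolomorphic f) (hG : M.IsPrimitive f G) : M.IsDiscreteHolomorphic G := by
  intro q
  have h0 := hG q 0
  have h1 := hG q 1
  have h2 := hG q 2
  have hp := M.parallelogram q
  have hfq := hf q
  simp only [edgeIntegral, Fin.reduceAdd, zero_add] at h0 h1 h2
  simp only [vertex] at *
  have e : z (M.corner q 2) = z (M.corner q 1) + z (M.corner q 3) - z (M.corner q 0) := by
    linear_combination hp
  rw [e] at hfq h1 h2 ⊢
  generalize z (M.corner q 0) = z0 at *
  generalize z (M.corner q 1) = z1 at *
  generalize z (M.corner q 3) = z3 at *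
  linear_combination (z3 - z1) * (h0 + h1) - (z1 + z3 - z0 - z0) * (h1 + h2) -
    (z1 - z0) / 2 * hfq

theorem pathIntegral_eq_sub (M : CriticalMap z δ) {f G : M.vertices → ℂ}
    (hG : M.IsPrimitive f G) {x y : M.vertices} (w : M.graph.Walk x y) :
    M.pathIntegral f w = G y - G x := by
  induction w with
  | nil => simp [pathIntegral]
  | @cons x y t h w ih =>
    have hxy : G y - G x = M.edgeIntegral f x y := by
      rcases ((SimpleGraph.fromRel_adj _ _ _).1 h).2 with ⟨q, i, rfl, rfl⟩ | ⟨q, i, rfl, rfl⟩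
      · exact hG q i
      · rw [edgeIntegral_symm, ← hG q i]; ring
    rw [pathIntegral, ih]
    rw [edgeIntegral] at hxy
    rw [← hxy]; ring

theorem integral_eq_sub (M : CriticalMap z δ) (hM : M.graph.Connected) {f G : M.vertices → ℂ}
    (hG : M.IsPrimitive f G) (o x : M.vertices) : M.integral o f x = G x - G o := by
  rw [integral, dif_pos (hM.preconnected o x), M.pathIntegral_eq_sub hG]

theorem isDiscreteHolomorphic_monomial [CompactSpace U] [SimplyConnectedSpace U]
    (hz : Continuous z) (M : CriticalMap z δ) (hM : M.graph.Connected) (o : M.vertices) (m : ℕ) :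
    M.IsDiscreteHolomorphic (M.monomial o m) := by
  induction m with
  | zero => intro q; simp [monomial]
  | succ m ih =>
    obtain ⟨G, hG⟩ := M.exists_isPrimitive hz ih
    have h := IsPrimitive.isDiscreteHolomorphic M ih hG
    intro q
    simp only [monomial, M.integral_eq_sub hM hG]
    linear_combination (m + 1 : ℂ) * h q

theorem monomial_succ_eq_pathIntegral [CompactSpace U] [SimplyConnectedSpace U]
    (hz : Continuous z) (M : CriticalMap z δ) (hM : M.graph.Connected) (o : M.vertices) (m : ℕ)
    (x : M.vertices) (w : M.graph.Walk o x) :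
    M.monomial o (m + 1) x = (m + 1 : ℂ) * M.pathIntegral (M.monomial o m) w := by
  obtain ⟨G, hG⟩ := M.exists_isPrimitive hz (M.isDiscreteHolomorphic_monomial hz hM o m)
  rw [M.pathIntegral_eq_sub hG, ← M.integral_eq_sub hM hG, monomial]

end CriticalMap

/-! ### Chains of faces and edge paths -/

/-- The nerve graph of the members of a closed cover meeting a connected set is connected. -/
theorem preconnected_nerve {X ι : Type*} [TopologicalSpace X] [Finite ι] (K : ι → Set X)
    (hK : ∀ i, IsClosed (K i)) {S : Set X} (hS : IsPreconnected S)
    (hcov : ∀ x ∈ S, ∃ i, x ∈ K i) :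
    (SimpleGraph.fromRel fun i j : {i // (K i ∩ S).Nonempty} =>
      (K i ∩ K j).Nonempty).Preconnected := by
  set H := SimpleGraph.fromRel fun i j : {i // (K i ∩ S).Nonempty} => (K i ∩ K j).Nonempty
  intro a b
  by_contra hab
  let A : Set {i // (K i ∩ S).Nonempty} := {i | H.Reachable a i}
  have hcl : ∀ A : Set {i // (K i ∩ S).Nonempty}, IsClosed (⋃ i ∈ A, K i) := fun A =>
    (toFinite A).isClosed_biUnion fun i _ => hK i
  have hne : ∀ (A : Set {i // (K i ∩ S).Nonempty}) (i), i ∈ A →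
      (S ∩ ⋃ i ∈ A, K i).Nonempty := by
    rintro A ⟨i, x, hxK, hxS⟩ hi
    exact ⟨x, hxS, mem_iUnion₂.2 ⟨⟨i, x, hxK, hxS⟩, hi, hxK⟩⟩
  -- The members reachable from `a` and the remaining ones have closed unions covering `S`; a common
  -- point would give an edge between the two classes.
  obtain ⟨x, -, hx1, hx2⟩ := isPreconnected_closed_iff.1 hS (⋃ i ∈ A, K i) (⋃ i ∈ Aᶜ, K i)
    (hcl _) (hcl _) (by
      intro x hx
      obtain ⟨i, hi⟩ := hcov x hx
      by_cases h : (⟨i, x, hi, hx⟩ : {i // (K i ∩ S).Nonempty}) ∈ A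
      · exact Or.inl (mem_iUnion₂.2 ⟨_, h, hi⟩)
      · exact Or.inr (mem_iUnion₂.2 ⟨_, h, hi⟩))
    (hne A a (SimpleGraph.Reachable.refl a)) (hne Aᶜ b hab)
  obtain ⟨i, hi, hxi⟩ := mem_iUnion₂.1 hx1
  obtain ⟨j, hj, hxj⟩ := mem_iUnion₂.1 hx2
  have hij : i ≠ j := fun h => hj (h ▸ hi)
  have hadj : H.Adj i j := (SimpleGraph.fromRel_adj _ _ _).2 ⟨hij, Or.inl ⟨x, hxi, hxj⟩⟩
  exact hj (SimpleGraph.Reachable.trans hi hadj.reachable)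

/-- Two members of a closed cover meeting a connected set are linked by a chain of bounded
length. -/
theorem exists_walk_nerve {X ι : Type*} [TopologicalSpace X] [Finite ι] (K : ι → Set X)
    (hK : ∀ i, IsClosed (K i)) {S : Set X} (hS : IsPreconnected S)
    (hcov : ∀ x ∈ S, ∃ i, x ∈ K i) (a b : {i // (K i ∩ S).Nonempty}) :
    ∃ w : (SimpleGraph.fromRel fun i j : {i // (K i ∩ S).Nonempty} =>
      (K i ∩ K j).Nonempty).Walk a b, w.length + 1 ≤ Nat.card {i // (K i ∩ S).Nonempty} := by
  classical
  have := Fintype.ofFinite {i // (K i ∩ S).Nonempty}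
  obtain ⟨w⟩ := preconnected_nerve K hK hS hcov a b
  refine ⟨w.bypass, ?_⟩
  rw [Nat.card_eq_fintype_card]
  exact (SimpleGraph.Walk.bypass_isPath w).length_lt

namespace CriticalMap

variable {U : Type*} [TopologicalSpace U] {z : U → ℂ} {δ : ℝ}

theorem graph_adj (M : CriticalMap z δ) (q : M.Face) (i : Fin 4) :
    M.graph.Adj (M.vertex q i) (M.vertex q (i + 1)) := by
  refine (SimpleGraph.fromRel_adj _ _ _).2 ⟨fun h => ?_, Or.inl ⟨q, i, rfl, rfl⟩⟩
  have h1 := M.side_length q i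
  have h2 : M.corner q i = M.corner q (i + 1) := congrArg Subtype.val h
  rw [← h2, dist_self] at h1
  exact M.side_pos.ne h1

theorem exists_walk_corners (M : CriticalMap z δ) (q : M.Face) (i j : Fin 4) :
    ∃ w : M.graph.Walk (M.vertex q i) (M.vertex q j), w.length ≤ 2 := by
  have h : j = i ∨ j = i + 1 ∨ j = i + 1 + 1 ∨ i = j + 1 := by
    revert i j; decide
  rcases h with rfl | rfl | rfl | rfl
  · exact ⟨.nil, by simp⟩
  · exact ⟨.cons (M.graph_adj q i) .nil, by simp⟩
  · exact ⟨.cons (M.graph_adj q i) (.cons (M.graph_adj q (i + 1)) .nil), by simp⟩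
  · exact ⟨.cons (M.graph_adj q j).symm .nil, by simp⟩

theorem cover_mem (M : CriticalMap z δ) (x : U) : ∃ q, x ∈ M.carrier q := by
  simpa using (eq_univ_iff_forall.1 M.cover x)

/-- Vertices of faces meeting a connected set are joined by an edge path whose length is bounded
by the number of these faces. -/
theorem exists_walk_of_isPreconnected (M : CriticalMap z δ) {S : Set U} (hS : IsPreconnected S)
    {q q' : M.Face} (hq : (M.carrier q ∩ S).Nonempty) (hq' : (M.carrier q' ∩ S).Nonempty)
    (i j : Fin 4) : ∃ w : M.graph.Walk (M.vertex q i) (M.vertex q' j),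
      w.length ≤ 2 * Nat.card {q // (M.carrier q ∩ S).Nonempty} := by
  have := M.finite_face
  obtain ⟨w, hw⟩ := exists_walk_nerve M.carrier M.isClosed_carrier hS
    (fun x _ => M.cover_mem x) ⟨q, hq⟩ ⟨q', hq'⟩
  -- A chain of length `n` has `n + 1` faces, consecutive ones share a corner, and crossing a face
  -- takes at most two edges.
  have key : ∀ (a b : {q // (M.carrier q ∩ S).Nonempty})
      (w : (SimpleGraph.fromRel fun i j : {q // (M.carrier q ∩ S).Nonempty} =>
        (M.carrier i ∩ M.carrier j).Nonempty).Walk a b) (i j : Fin 4),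
      ∃ v : M.graph.Walk (M.vertex a i) (M.vertex b j), v.length ≤ 2 * (w.length + 1) := by
    intro a b w
    induction w with
    | nil => exact fun i j => M.exists_walk_corners _ i j
    | @cons a c b h w ih =>
      intro i j
      have hac : (M.carrier a ∩ M.carrier c).Nonempty := by
        rcases ((SimpleGraph.fromRel_adj _ _ _).1 h).2 with h | h
        · exact h
        · rwa [inter_comm]
      obtain ⟨k, l, hkl⟩ := M.exists_common_corner hac
      obtain ⟨v₁, hv₁⟩ := M.exists_walk_corners a i k
      obtain ⟨v₂, hv₂⟩ := ih l j
      refine ⟨v₁.append (v₂.copy hkl.symm rfl), ?_⟩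
      rw [SimpleGraph.Walk.length_append, SimpleGraph.Walk.length_copy,
        SimpleGraph.Walk.length_cons]
      omega
  obtain ⟨v, hv⟩ := key _ _ w i j
  exact ⟨v, hv.trans (by omega)⟩

/-- This bound depends on the map; it serves for the finitely many maps that are not yet fine. -/
theorem exists_walk_le [PreconnectedSpace U] (M : CriticalMap z δ) :
    ∃ L : ℕ, ∀ x y : M.vertices, ∃ w : M.graph.Walk x y, w.length ≤ L := by
  refine ⟨2 * Nat.card {q // (M.carrier q ∩ univ).Nonempty}, ?_⟩
  rintro ⟨_, q, i, rfl⟩ ⟨_, q', j, rfl⟩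
  exact M.exists_walk_of_isPreconnected isPreconnected_univ ⟨_, M.corner_mem q i, trivial⟩
    ⟨_, M.corner_mem q' j, trivial⟩ i j

theorem graph_connected [ConnectedSpace U] (M : CriticalMap z δ) : M.graph.Connected := by
  obtain ⟨p⟩ := (inferInstance : Nonempty U)
  obtain ⟨q, -⟩ := M.cover_mem p
  obtain ⟨L, hL⟩ := M.exists_walk_le
  have : Nonempty M.vertices := ⟨M.vertex q 0⟩
  exact ⟨fun x y => ⟨(hL x y).choose⟩⟩

end CriticalMap

/-! ### Uniform bound for the metric length of edge paths -/

/-- Disjoint discs of radius `r` covered by discs of radius `R`: comparison of areas. -/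
theorem card_mul_sq_le_of_packing {ι κ : Type*} (s : Finset ι) (t : Finset κ) (c : ι → ℂ)
    (d : κ → ℂ) {r R : ℝ} (hr : 0 ≤ r) (hR : 0 ≤ R)
    (hdisj : (s : Set ι).PairwiseDisjoint fun i => Metric.ball (c i) r)
    (hsub : ∀ i ∈ s, Metric.ball (c i) r ⊆ ⋃ k ∈ t, Metric.closedBall (d k) R) :
    s.card * r ^ 2 ≤ t.card * R ^ 2 := by
  have h1 : ∑ i ∈ s, MeasureTheory.volume (Metric.ball (c i) r) ≤
      ∑ k ∈ t, MeasureTheory.volume (Metric.closedBall (d k) R) := by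
    rw [← MeasureTheory.measure_biUnion_finset hdisj fun i _ => measurableSet_ball]
    exact (MeasureTheory.measure_mono (iUnion₂_subset hsub)).trans
      (MeasureTheory.measure_biUnion_finset_le _ _)
  simp only [Complex.volume_ball, Complex.volume_closedBall, Finset.sum_const, nsmul_eq_mul] at h1
  rw [← mul_assoc, ← mul_assoc] at h1
  have h2 : (s.card : ENNReal) * ENNReal.ofReal r ^ 2 ≤ t.card * ENNReal.ofReal R ^ 2 := by
    rwa [ENNReal.mul_le_mul_iff_left (by simp [NNReal.pi_ne_zero]) (by simp)] at h1
  have h3 := ENNReal.toReal_mono (by finiteness) h2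
  simpa [ENNReal.toReal_mul, ENNReal.toReal_pow, ENNReal.toReal_ofReal hr,
    ENNReal.toReal_ofReal hR] using h3

/-- Small connected sets meeting a compact set on which a locally injective map is injective stay
in a neighbourhood on which the map is injective. -/
theorem exists_injOn_of_small {U : Type*} [TopologicalSpace U] [CompactSpace U] [T2Space U]
    {z : U → ℂ} (hz : IsDevelopingMap z) {K : Set U} (hK : IsClosed K) (hinj : InjOn z K) :
    ∃ W, InjOn z W ∧ ∃ ε > 0, ∀ C : Set U, IsPreconnected C → (C ∩ K).Nonempty →
      (∀ a ∈ C, ∀ b ∈ C, dist (z a) (z b) < ε) → C ⊆ W := by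
  obtain ⟨t, ht, htinj⟩ := hinj.exists_mem_nhdsSet hK.isCompact
    (fun x _ => hz.continuous.continuousAt) fun x _ => hz.locally_injective x
  obtain ⟨W, hWo, hKW, hWt⟩ := mem_nhdsSet_iff_exists.1 ht
  obtain ⟨V, hVo, hKV, hVW⟩ := normal_exists_closure_subset hK hWo hKW
  have hWinj := htinj.mono hWt
  -- The distance between these two compact images serves as `ε`: a connected set that meets `K` and
  -- leaves `V` crosses `frontier V`, hence has a large image.
  have hdisj : Disjoint (z '' K) (z '' frontier V) := by
    rw [Set.disjoint_left]
    rintro _ ⟨x, hx, rfl⟩ ⟨y, hy, hxy⟩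
    have := hWinj (hVW (frontier_subset_closure hy)) (hKW hx) hxy
    rw [hVo.frontier_eq] at hy
    exact hy.2 (this ▸ hKV hx)
  obtain ⟨r, hr, hrlt⟩ := Metric.exists_pos_forall_lt_edist (hK.isCompact.image hz.continuous)
    ((isClosed_frontier (s := V)).isCompact.image hz.continuous).isClosed hdisj
  refine ⟨W, hWinj, r, hr, fun C hC hCK hsmall => ?_⟩
  obtain ⟨x, hxC, hxK⟩ := hCK
  by_contra hCW
  have hCV : ¬ C ⊆ V := fun h => hCW (h.trans (subset_closure.trans hVW))
  obtain ⟨y, hyC, hyV⟩ := not_subset.1 hCV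
  obtain ⟨p, hpC, hpV⟩ : (C ∩ frontier V).Nonempty := by
    by_contra! hemp
    have hcl : C ⊆ V ∪ (closure V)ᶜ := by
      intro u hu
      by_cases huV : u ∈ V
      · exact Or.inl huV
      · refine Or.inr fun hucl => ?_
        have : u ∈ C ∩ frontier V := ⟨hu, by rw [hVo.frontier_eq]; exact ⟨hucl, huV⟩⟩
        rw [hemp] at this
        exact this
    obtain ⟨u, -, hu1, hu2⟩ := hC V (closure V)ᶜ hVo isClosed_closure.isOpen_compl hcl
      ⟨x, hxC, hKV hxK⟩ ⟨y, hyC, (hcl hyC).resolve_left hyV⟩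
    exact hu2 (subset_closure hu1)
  have h1 := hrlt (z x) ⟨x, hxK, rfl⟩ (z p) ⟨p, hpV, rfl⟩
  have h2 := hsmall x hxC p hpC
  rw [edist_nndist, ENNReal.coe_lt_coe, ← NNReal.coe_lt_coe, coe_nndist] at h1
  exact absurd h1 h2.not_gt

namespace CriticalMap

variable {U : Type*} [TopologicalSpace U] {z : U → ℂ} {δ : ℝ}

theorem norm_side_one (M : CriticalMap z δ) (q : M.Face) : ‖M.pts q 1 - M.pts q 0‖ = δ := by
  have := M.side_length q 0
  rwa [zero_add, dist_comm, dist_eq_norm] at this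

theorem norm_side_three (M : CriticalMap z δ) (q : M.Face) : ‖M.pts q 3 - M.pts q 0‖ = δ := by
  have := M.side_length q 3
  rwa [show (3 : Fin 4) + 1 = 0 from rfl, dist_eq_norm] at this

theorem dist_le_of_mem_carrier (M : CriticalMap z δ) {q : M.Face} {x y : U}
    (hx : x ∈ M.carrier q) (hy : y ∈ M.carrier q) : dist (z x) (z y) ≤ 2 * δ := by
  have hp := M.parallelogram q
  have hD := M.planeCross_ne_zero q
  have hx' : z x ∈ convexHull ℝ (range (M.pts q)) := M.image_carrier_eq q ▸ ⟨x, hx, rfl⟩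
  have hy' : z y ∈ convexHull ℝ (range (M.pts q)) := M.image_carrier_eq q ▸ ⟨y, hy, rfl⟩
  rw [mem_parallelogram_iff hp hD] at hx' hy'
  obtain ⟨⟨a0, a1⟩, b0, b1⟩ := hx'
  obtain ⟨⟨c0, c1⟩, d0, d1⟩ := hy'
  rw [dist_eq_norm, frame_repr hD (z x), frame_repr hD (z y)]
  generalize frameFst (M.pts q) (z x) = a at *
  generalize frameSnd (M.pts q) (z x) = b at *
  generalize frameFst (M.pts q) (z y) = c at *
  generalize frameSnd (M.pts q) (z y) = d at *
  have : M.pts q 0 + a * (M.pts q 1 - M.pts q 0) + b * (M.pts q 3 - M.pts q 0) -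
      (M.pts q 0 + c * (M.pts q 1 - M.pts q 0) + d * (M.pts q 3 - M.pts q 0)) =
      ((a - c : ℝ) : ℂ) * (M.pts q 1 - M.pts q 0) +
        ((b - d : ℝ) : ℂ) * (M.pts q 3 - M.pts q 0) := by
    push_cast; ring
  rw [this]
  refine (norm_add_le _ _).trans ?_
  rw [norm_mul, norm_mul, M.norm_side_one, M.norm_side_three, Complex.norm_real,
    Complex.norm_real, Real.norm_eq_abs, Real.norm_eq_abs]
  have h1 : |a - c| ≤ 1 := abs_le.2 ⟨by linarith, by linarith⟩
  have h2 : |b - d| ≤ 1 := abs_le.2 ⟨by linarith, by linarith⟩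
  nlinarith [M.side_pos]

theorem inter_carrier_subset (M : CriticalMap z δ) {q q' : M.Face} (h : q ≠ q') {p : U}
    (hp : p ∈ M.carrier q ∩ M.carrier q') :
    ∃ i, ∃ t : ℝ, t ∈ Icc (0 : ℝ) 1 ∧
      z p = AffineMap.lineMap (M.pts q i) (M.pts q (i + 1)) t := by
  rcases M.inter_carrier q q' h with h0 | ⟨i, j, -, h1⟩ | ⟨i, j, -, h1⟩
  · rw [h0] at hp; exact hp.elim
  · rw [h1] at hp
    refine ⟨i, 0, by simp, ?_⟩
    rw [mem_singleton_iff.1 hp, AffineMap.lineMap_apply_zero, pts]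
  · rw [h1] at hp
    have hp2 := hp.2
    rw [segment_eq_image_lineMap] at hp2
    obtain ⟨t, ht, htz⟩ := hp2
    exact ⟨i, t, ht, htz.symm⟩

/-- A lower bound for all angles of a critical map. -/
def AngleBound (M : CriticalMap z δ) (η : ℝ) : Prop :=
  ∀ (q : M.Face) i, η ≤ EuclideanGeometry.angle (z (M.corner q (i - 1))) (z (M.corner q i))
    (z (M.corner q (i + 1)))

/-- The number of faces that meet a segment, in a region where the coordinate is injective. -/
theorem card_faces_le (M : CriticalMap z δ) {η : ℝ} (hη : 0 < η) (hη' : η ≤ Real.pi / 2)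
    (hang : M.AngleBound η) {W : Set U} (hW : InjOn z W) (F : Finset M.Face)
    (hF : ∀ q ∈ F, M.carrier q ⊆ W) {a b : ℂ} {N : ℕ} (hN : 0 < N) (hab : dist a b ≤ N * δ)
    (hmeet : ∀ q ∈ F, ∃ p ∈ M.carrier q, z p ∈ segment ℝ a b) :
    F.card * Real.sin η ^ 2 ≤ 36 * (N + 1) := by
  have hδ := M.side_pos
  have hsin : 0 < Real.sin η :=
    Real.sin_pos_of_pos_of_lt_pi hη (hη'.trans_lt (by linarith [Real.pi_pos]))
  -- The area is at least `δ ^ 2 * sin η`, so a disc of this radius about the centre stays off the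
  -- sides.
  set r := δ * Real.sin η / 2 with hr
  have hball : ∀ q, ∀ x ∈ Metric.ball ((M.pts q 0 + M.pts q 2) / 2) r,
      frameFst (M.pts q) x ∈ Ioo (0 : ℝ) 1 ∧ frameSnd (M.pts q) x ∈ Ioo (0 : ℝ) 1 := by
    intro q x hx
    refine frame_mem_Ioo_of_mem_ball (M.parallelogram q) (M.planeCross_ne_zero q) hδ
      (M.norm_side_one q) (M.norm_side_three q) ?_ hx
    have h := le_abs_planeCross (w := M.pts q) (M.parallelogram q) hη.le (M.side_length q) (hang q)
    refine le_trans (le_of_eq ?_) h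
    rw [hr]; ring
  have hsubim : ∀ q, Metric.ball ((M.pts q 0 + M.pts q 2) / 2) r ⊆ z '' M.carrier q := by
    intro q x hx
    rw [M.image_carrier_eq q, mem_parallelogram_iff (M.parallelogram q) (M.planeCross_ne_zero q)]
    exact ⟨Ioo_subset_Icc_self (hball q x hx).1, Ioo_subset_Icc_self (hball q x hx).2⟩
  -- The segment is cut by `N + 1` points at spacing at most `δ`; the radius `3 * δ` adds the bound
  -- `2 * δ` for the diameter of a lozenge. The ratio of `(3 * δ) ^ 2` to `r ^ 2` yields the factor
  -- `36`.
  have h := card_mul_sq_le_of_packing F (Finset.range (N + 1))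
    (fun q => (M.pts q 0 + M.pts q 2) / 2)
    (fun k => AffineMap.lineMap a b ((k : ℝ) / N)) (r := r) (R := 3 * δ) (by positivity)
    (by positivity) (by
      intro q hq q' hq' hne
      rw [Function.onFun, Set.disjoint_left]
      intro x hx hx'
      obtain ⟨p, hp, hpx⟩ := hsubim q hx
      obtain ⟨p', hp', hpx'⟩ := hsubim q' hx'
      -- Injectivity of `z` on `W` turns an overlap of planar discs into a common point of two
      -- faces; it must lie on a side, which the discs avoid.
      obtain rfl : p = p' := hW (hF q hq hp) (hF q' hq' hp') (hpx.trans hpx'.symm)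
      obtain ⟨i, t, ht, hzt⟩ := M.inter_carrier_subset hne ⟨hp, hp'⟩
      obtain ⟨⟨h1, h2⟩, h3, h4⟩ := hball q x hx
      have hfr := frame_lineMap (w := M.pts q) (M.parallelogram q) (M.planeCross_ne_zero q) i t
      rw [← hzt, hpx, Prod.ext_iff] at hfr
      obtain ⟨e1, e2⟩ := hfr
      dsimp only at e1 e2
      rw [e1] at h1 h2
      rw [e2] at h3 h4
      clear e1 e2 hzt
      fin_cases i <;> simp at h1 h2 h3 h4) (by
      intro q hq x hx
      obtain ⟨p, hp, rfl⟩ := hsubim q hx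
      obtain ⟨p₀, hp₀, hseg⟩ := hmeet q hq
      rw [segment_eq_image_lineMap] at hseg
      obtain ⟨t, ⟨ht0, ht1⟩, htz⟩ := hseg
      have hN' : (0 : ℝ) < N := by exact_mod_cast hN
      have hfl : ⌊t * N⌋₊ ≤ N := by
        refine Nat.floor_le_of_le ?_
        nlinarith
      refine mem_iUnion₂.2 ⟨⌊t * N⌋₊, Finset.mem_range.2 (by omega), ?_⟩
      rw [Metric.mem_closedBall]
      have h1 : dist (z p) (z p₀) ≤ 2 * δ := M.dist_le_of_mem_carrier hp hp₀
      have h2 : dist (z p₀) (AffineMap.lineMap a b ((⌊t * N⌋₊ : ℝ) / N)) ≤ δ := by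
        rw [← htz, dist_lineMap_lineMap]
        have h3 : dist t ((⌊t * N⌋₊ : ℝ) / N) ≤ 1 / N := by
          have f1 := Nat.floor_le (show 0 ≤ t * N by positivity)
          have f2 := Nat.lt_floor_add_one (t * N)
          have f3 : t - (⌊t * N⌋₊ : ℝ) / N = (t * N - ⌊t * N⌋₊) / N := by field_simp
          rw [Real.dist_eq, f3, abs_of_nonneg (div_nonneg (by linarith) hN'.le)]
          gcongr
          linarith
        calc _ ≤ 1 / N * (N * δ) := by gcongr
          _ = δ := by field_simp
      calc _ ≤ _ := dist_triangle _ (z p₀) _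
        _ ≤ 3 * δ := by linarith)
  rw [Finset.card_range, hr] at h
  push_cast at h
  have h5 : δ ^ 2 * (F.card * Real.sin η ^ 2) ≤ δ ^ 2 * (36 * (N + 1)) := by linarith
  exact le_of_mul_le_mul_left h5 (by positivity)

/-- Edge paths of a fine critical map joining two points of a face of a fixed critical map. -/
theorem exists_walk_bound_face [CompactSpace U] [T2Space U] (hz : IsDevelopingMap z) {β : ℝ}
    (B : CriticalMap z β) {η : ℝ} (hη : 0 < η) (hη' : η ≤ Real.pi / 2) (Q : B.Face) :
    ∃ δ₀ > 0, ∀ δ < δ₀, ∀ M : CriticalMap z δ, M.AngleBound η →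
      ∀ x ∈ B.carrier Q, ∀ y ∈ B.carrier Q, ∀ q q', x ∈ M.carrier q → y ∈ M.carrier q' →
        ∀ i j, ∃ w : M.graph.Walk (M.vertex q i) (M.vertex q' j),
          w.length * δ ≤ 72 * (2 * β + 2) / Real.sin η ^ 2 := by
  obtain ⟨W, hW, ε, hε, hsmall⟩ :=
    exists_injOn_of_small hz (B.isClosed_carrier Q) (B.injOn_carrier Q)
  -- The bound `ε / 2` keeps the fine faces that meet `Q` inside `W`, as their diameter is at most
  -- `2 * δ`; the bound `1` absorbs the rounding of `N` into the constant.
  refine ⟨min 1 (ε / 2), lt_min one_pos (half_pos hε),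
    fun δ hδ₀ M hang x hx y hy q q' hxq hyq' i j => ?_⟩
  have hδ := M.side_pos
  have hβ := B.side_pos
  have hδ1 : δ < 1 := hδ₀.trans_le (min_le_left _ _)
  have hδε : 2 * δ < ε := by
    have := hδ₀.trans_le (min_le_right _ _)
    linarith
  have hsin : 0 < Real.sin η :=
    Real.sin_pos_of_pos_of_lt_pi hη (hη'.trans_lt (by linarith [Real.pi_pos]))
  have := M.finite_face
  obtain ⟨S, hSQ, hS, hxS, hyS, hzS⟩ := B.exists_isPreconnected_segment hz.continuous Q hx hy
  obtain ⟨w, hw⟩ := M.exists_walk_of_isPreconnected hS ⟨x, hxq, hxS⟩ ⟨y, hyq', hyS⟩ i j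
  refine ⟨w, ?_⟩
  let F : Finset M.Face := (toFinite {q | (M.carrier q ∩ S).Nonempty}).toFinset
  have hcard : Nat.card {q // (M.carrier q ∩ S).Nonempty} = F.card :=
    Nat.card_eq_card_finite_toFinset _
  have hN : 0 < ⌈2 * β / δ⌉₊ := Nat.ceil_pos.2 (by positivity)
  have hlt : (⌈2 * β / δ⌉₊ : ℝ) < 2 * β / δ + 1 := Nat.ceil_lt_add_one (by positivity)
  have hF := M.card_faces_le hη hη' hang hW F (a := z x) (b := z y) (N := ⌈2 * β / δ⌉₊) (by
      intro q hq
      obtain ⟨p, hpq, hpS⟩ : (M.carrier q ∩ S).Nonempty := by simpa [F] using hq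
      refine hsmall _ ?_ ⟨p, hpq, hSQ hpS⟩ fun a ha b hb =>
        (M.dist_le_of_mem_carrier ha hb).trans_lt hδε
      have hpc : IsPathConnected (M.carrier q) :=
        ⟨p, hpq, fun {y} hy => M.joinedIn_carrier hz.continuous q hpq hy⟩
      exact hpc.isConnected.isPreconnected) hN (by
      refine (B.dist_le_of_mem_carrier hx hy).trans ?_
      rw [← div_le_iff₀ hδ]
      exact Nat.le_ceil _) (by
      intro q hq
      obtain ⟨p, hpq, hpS⟩ : (M.carrier q ∩ S).Nonempty := by simpa [F] using hq
      exact ⟨p, hpq, hzS ⟨p, hpS, rfl⟩⟩)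
  rw [hcard] at hw
  have hw' : (w.length : ℝ) ≤ 2 * F.card := by exact_mod_cast hw
  rw [le_div_iff₀ (by positivity)]
  have hNδ : ((⌈2 * β / δ⌉₊ : ℝ) + 1) * δ ≤ 2 * β + 2 := by
    calc _ ≤ (2 * β / δ + 1 + 1) * δ := by gcongr
      _ = 2 * β + 2 * δ := by field_simp; ring
      _ ≤ _ := by linarith
  calc w.length * δ * Real.sin η ^ 2 ≤ 2 * F.card * δ * Real.sin η ^ 2 := by gcongr
    _ = 2 * δ * (F.card * Real.sin η ^ 2) := by ring
    _ ≤ 2 * δ * (36 * (⌈2 * β / δ⌉₊ + 1)) := by gcongr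
    _ = 72 * (((⌈2 * β / δ⌉₊ : ℝ) + 1) * δ) := by ring
    _ ≤ 72 * (2 * β + 2) := by gcongr

/-- Any two vertices of a sufficiently fine critical map are joined by an edge path of bounded
metric length. -/
theorem exists_walk_bound [CompactSpace U] [T2Space U] [PreconnectedSpace U]
    (hz : IsDevelopingMap z) {β : ℝ} (B : CriticalMap z β) {η : ℝ} (hη : 0 < η)
    (hη' : η ≤ Real.pi / 2) :
    ∃ δ₀ > 0, ∃ L : ℝ, ∀ δ < δ₀, ∀ M : CriticalMap z δ, M.AngleBound η →
      ∀ x y : M.vertices, ∃ w : M.graph.Walk x y, w.length * δ ≤ L := by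
  have := B.finite_face
  choose d hd hwalk using fun Q => B.exists_walk_bound_face hz hη hη' Q
  set L₁ := 72 * (2 * β + 2) / Real.sin η ^ 2 with hL₁
  have hL₁0 : 0 ≤ L₁ := by have := B.side_pos; positivity
  have hδ₀ : ∃ δ₀ > 0, ∀ Q, δ₀ ≤ d Q := by
    rcases isEmpty_or_nonempty B.Face with h | h
    · exact ⟨1, one_pos, fun Q => h.elim Q⟩
    · obtain ⟨Q, hQ⟩ := Finite.exists_min d
      exact ⟨d Q, hd Q, hQ⟩
  obtain ⟨δ₀, hδ₀, hle⟩ := hδ₀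
  refine ⟨δ₀, hδ₀, Nat.card {q // (B.carrier q ∩ univ).Nonempty} * L₁, fun δ hδ M hang => ?_⟩
  have key : ∀ (a b : {q // (B.carrier q ∩ univ).Nonempty})
      (w : (SimpleGraph.fromRel fun i j : {q // (B.carrier q ∩ univ).Nonempty} =>
        (B.carrier i ∩ B.carrier j).Nonempty).Walk a b),
      ∀ x ∈ B.carrier a, ∀ y ∈ B.carrier b, ∀ q q', x ∈ M.carrier q → y ∈ M.carrier q' →
        ∀ i j, ∃ v : M.graph.Walk (M.vertex q i) (M.vertex q' j),
          v.length * δ ≤ (w.length + 1) * L₁ := by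
    intro a b w
    induction w with
    | @nil a =>
      intro x hx y hy q q' hq hq' i j
      obtain ⟨v, hv⟩ := hwalk a δ (hδ.trans_le (hle a)) M hang x hx y hy q q' hq hq' i j
      exact ⟨v, by simpa using hv⟩
    | @cons a c b h w ih =>
      intro x hx y hy q q' hq hq' i j
      obtain ⟨p, hpa, hpc⟩ : (B.carrier a ∩ B.carrier c).Nonempty := by
        rcases ((SimpleGraph.fromRel_adj _ _ _).1 h).2 with h | h
        · exact h
        · rwa [inter_comm]
      -- The path passes from one coarse face to the next through corner `0` of a fine face
      -- containing a common point `p`.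
      obtain ⟨k, hk⟩ := M.cover_mem p
      obtain ⟨v₁, hv₁⟩ := hwalk a δ (hδ.trans_le (hle a)) M hang x hx p hpa q k hq hk i 0
      obtain ⟨v₂, hv₂⟩ := ih p hpc y hy k q' hk hq' 0 j
      refine ⟨v₁.append v₂, ?_⟩
      rw [SimpleGraph.Walk.length_append, SimpleGraph.Walk.length_cons]
      push_cast
      linarith
  rintro ⟨_, q, i, rfl⟩ ⟨_, q', j, rfl⟩
  obtain ⟨a, ha⟩ := B.cover_mem (M.corner q i)
  obtain ⟨b, hb⟩ := B.cover_mem (M.corner q' j)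
  obtain ⟨w, hw⟩ := exists_walk_nerve B.carrier B.isClosed_carrier isPreconnected_univ
    (fun x _ => B.cover_mem x) ⟨a, _, ha, trivial⟩ ⟨b, _, hb, trivial⟩
  obtain ⟨v, hv⟩ := key _ _ w _ ha _ hb q q' (M.corner_mem q i) (M.corner_mem q' j) i j
  refine ⟨v, hv.trans ?_⟩
  gcongr
  exact_mod_cast hw

end CriticalMap

/-- Along a refining sequence, any two vertices are joined by edge paths of uniformly bounded
metric length. -/
theorem IsRefining.exists_walk_bound {U : Type*} [TopologicalSpace U] [CompactSpace U] [T2Space U]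
    [PreconnectedSpace U] {z : U → ℂ} (hz : IsDevelopingMap z) {δ : ℕ → ℝ}
    {M : ∀ n, CriticalMap z (δ n)} (hM : IsRefining M) :
    ∃ L : ℝ, ∀ n, ∀ x y : (M n).vertices, ∃ w : (M n).graph.Walk x y, w.length * δ n ≤ L := by
  obtain ⟨η, hη, hang⟩ := hM.angle_bound
  obtain ⟨δ₀, hδ₀, L, hL⟩ := (M 0).exists_walk_bound hz
    (lt_min hη (half_pos Real.pi_pos)) (min_le_right η (Real.pi / 2))
  obtain ⟨N, hN⟩ := eventually_atTop.1 (hM.tendsto_side.eventually (gt_mem_nhds hδ₀))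
  choose l hl using fun n => (M n).exists_walk_le
  have hnn : ∀ n, 0 ≤ l n * δ n := fun n => mul_nonneg (Nat.cast_nonneg _) (M n).side_pos.le
  -- The sum dominates each of the finitely many bounds for `n < N`.
  refine ⟨max L (∑ n ∈ Finset.range N, l n * δ n), fun n x y => ?_⟩
  rcases lt_or_ge n N with h | h
  · obtain ⟨w, hw⟩ := hl n x y
    refine ⟨w, le_max_of_le_right (le_trans ?_ (Finset.single_le_sum (fun n _ => hnn n)
      (Finset.mem_range.2 h)))⟩
    have := (M n).side_pos
    gcongr
  · obtain ⟨w, hw⟩ := hL (δ n) (hN n h) (M n)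
      (fun q i => (min_le_left _ _).trans (hang n q i)) x y
    exact ⟨w, hw.trans (le_max_left _ _)⟩

/-! ### Accumulated errors and convergence -/

theorem exists_lipschitz_bound (m : ℕ) (R : ℝ) : ∃ C : ℝ, 0 ≤ C ∧ ∀ a h : ℂ, ‖a‖ ≤ R → ‖h‖ ≤ R →
    ‖(a + h) ^ m - a ^ m‖ ≤ C * ‖h‖ := by
  obtain ⟨P, hP, hP'⟩ := exists_taylor_one m
  obtain ⟨C, hC0, hC⟩ := exists_bound_of_continuous
    (fun p => m * p.1 ^ (m - 1) + p.2 * P p) (by fun_prop) R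
  refine ⟨C, hC0, fun a h ha hh => ?_⟩
  have : (a + h) ^ m - a ^ m = (m * a ^ (m - 1) + h * P (a, h)) * h := by
    rw [hP']; ring
  rw [this, norm_mul]
  exact mul_le_mul_of_nonneg_right (hC a h ha hh) (norm_nonneg _)

namespace CriticalMap

variable {U : Type*} [TopologicalSpace U] {z : U → ℂ} {δ : ℝ}

theorem norm_sub_of_adj (M : CriticalMap z δ) {x y : M.vertices} (h : M.graph.Adj x y) :
    ‖z y - z x‖ = δ := by
  rcases ((SimpleGraph.fromRel_adj _ _ _).1 h).2 with ⟨q, i, rfl, rfl⟩ | ⟨q, i, rfl, rfl⟩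
  · rw [← dist_eq_norm, dist_comm]; exact M.side_length q i
  · rw [← dist_eq_norm]; exact M.side_length q i

/-- Accumulation of local errors of integration along a path. -/
theorem norm_pathIntegral_sub_le (M : CriticalMap z δ) {f F : M.vertices → ℂ} {c : ℂ} {ε : ℝ}
    (h : ∀ x y, M.graph.Adj x y → ‖c * M.edgeIntegral f x y - (F y - F x)‖ ≤ ε)
    {x y : M.vertices} (w : M.graph.Walk x y) :
    ‖c * M.pathIntegral f w - (F y - F x)‖ ≤ w.length * ε := by
  induction w with
  | nil => simp [pathIntegral]
  | @cons x y t hxy w ih =>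
    have h1 := h x y hxy
    have e : c * M.pathIntegral f (SimpleGraph.Walk.cons hxy w) - (F t - F x) =
        (c * M.edgeIntegral f x y - (F y - F x)) + (c * M.pathIntegral f w - (F t - F y)) := by
      rw [pathIntegral, edgeIntegral]; ring
    rw [e, SimpleGraph.Walk.length_cons]
    refine (norm_add_le _ _).trans ?_
    push_cast
    linarith

/-- Discrete monomials approximate powers at the vertices with an error of second order. -/
theorem exists_vertex_error [CompactSpace U] [SimplyConnectedSpace U] (hz : Continuous z)
    (R L : ℝ) (hR : ∀ p, ‖z p‖ ≤ R) (m : ℕ) : ∃ C : ℝ, 0 ≤ C ∧ ∀ (δ : ℝ) (M : CriticalMap z δ),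
      (∀ x y : M.vertices, ∃ w : M.graph.Walk x y, w.length * δ ≤ L) → ∀ o x : M.vertices,
        ‖M.monomial o m x - (z x - z o) ^ m‖ ≤ C * δ ^ 2 := by
  induction m with
  | zero => exact ⟨0, le_rfl, fun δ M _ o x => by simp [monomial]⟩
  | succ m ih =>
    obtain ⟨C, hC0, hC⟩ := ih
    obtain ⟨T, hT0, hT⟩ := exists_trapezoid_bound m (2 * R)
    have hnorm : ∀ p p', ‖z p - z p'‖ ≤ 2 * R := fun p p' => by
      refine (norm_sub_le _ _).trans ?_
      linarith [hR p, hR p']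
    -- Per edge: `(m + 1) * C` is the inherited error and `T` the trapezoidal one, both times `δ ^
    -- 3`; the number of edges times `δ` is at most `|L|`.
    refine ⟨|L| * ((m + 1) * C + T), by positivity, fun δ M hL o x => ?_⟩
    have hδ := M.side_pos
    obtain ⟨w, hw⟩ := hL o x
    have h := M.norm_pathIntegral_sub_le (f := M.monomial o m)
      (F := fun y => (z y - z o) ^ (m + 1)) (c := (m + 1 : ℂ))
      (ε := ((m + 1) * C + T) * δ ^ 3) (by
        intro x y hxy
        have hd := M.norm_sub_of_adj hxy
        have hx := hC δ M hL o x
        have hy := hC δ M hL o y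
        have ht := hT (z x - z o) (z y - z x) (hnorm _ _) (hnorm _ _)
        rw [show z x - z o + (z y - z x) = z y - z o by ring, hd] at ht
        have e : (m + 1 : ℂ) * M.edgeIntegral (M.monomial o m) x y -
            ((z y - z o) ^ (m + 1) - (z x - z o) ^ (m + 1)) =
            (m + 1) * (((M.monomial o m x - (z x - z o) ^ m) +
              (M.monomial o m y - (z y - z o) ^ m)) / 2 * (z y - z x)) +
            ((m + 1) * (((z x - z o) ^ m + (z y - z o) ^ m) / 2 * (z y - z x)) -
              ((z y - z o) ^ (m + 1) - (z x - z o) ^ (m + 1))) := by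
          rw [edgeIntegral]; ring
        rw [e]
        refine (norm_add_le _ _).trans ?_
        have hm : ‖(m + 1 : ℂ)‖ = m + 1 := by
          have := Complex.norm_natCast (m + 1)
          push_cast at this
          exact this
        have hs : ‖((M.monomial o m x - (z x - z o) ^ m) +
            (M.monomial o m y - (z y - z o) ^ m)) / 2‖ ≤ C * δ ^ 2 := by
          rw [norm_div, Complex.norm_two]
          have := norm_add_le (M.monomial o m x - (z x - z o) ^ m)
            (M.monomial o m y - (z y - z o) ^ m)
          linarith
        rw [norm_mul, norm_mul, hm, hd]
        calc _ ≤ (m + 1 : ℝ) * (C * δ ^ 2 * δ) + T * δ ^ 3 := by gcongr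
          _ = _ := by ring) w
    rw [← M.monomial_succ_eq_pathIntegral hz M.graph_connected o m x w] at h
    simp only [sub_self, ne_eq, Nat.add_eq_zero_iff, one_ne_zero, and_false, not_false_eq_true,
      zero_pow, sub_zero] at h
    refine h.trans ?_
    calc (w.length : ℝ) * (((m + 1) * C + T) * δ ^ 3)
        = (w.length * δ) * (((m + 1) * C + T) * δ ^ 2) := by ring
      _ ≤ |L| * (((m + 1) * C + T) * δ ^ 2) := by
        gcongr
        exact hw.trans (le_abs_self L)
      _ = _ := by ring

/-- A bound at the vertices passes to piecewise harmonic extensions. -/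
theorem exists_extension_error [CompactSpace U] (hz : Continuous z) (R : ℝ)
    (hR : ∀ p, ‖z p‖ ≤ R) (m : ℕ) : ∃ I : ℝ, 0 ≤ I ∧ ∀ (δ : ℝ) (M : CriticalMap z δ) (p₀ : U)
      (f : M.vertices → ℂ) (E : ℝ), (∀ x : M.vertices, ‖f x - (z x - z p₀) ^ m‖ ≤ E) →
        ∀ g, M.IsHarmonicExtension f g → ∀ p, ‖g p - (z p - z p₀) ^ m‖ ≤ E + I * δ ^ 2 := by
  obtain ⟨I, hI0, hI⟩ := exists_interpolation_bound m (2 * R)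
  have hnorm : ∀ p p', ‖z p - z p'‖ ≤ 2 * R := fun p p' => by
    refine (norm_sub_le _ _).trans ?_
    linarith [hR p, hR p']
  refine ⟨I, hI0, fun δ M p₀ f E hE g hg p => ?_⟩
  obtain ⟨q, hpq⟩ := M.cover_mem p
  obtain ⟨h, hgh, hcont, hharm, hside⟩ := hg q
  have hK : IsCompact (z '' M.carrier q) := (M.isClosed_carrier q).isCompact.image hz
  have hmax := norm_harmonic_le_of_frontier_le (h := h - fun w => (w - z p₀) ^ m) hK
    (hcont.sub (by fun_prop))
    (hharm.sub fun w _ => AnalyticAt.harmonicAt (by fun_prop)) (c := E + I * δ ^ 2) (by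
      intro w hw
      rw [M.image_carrier_eq q] at hw
      obtain ⟨i, t, ht, rfl⟩ := frontier_parallelogram_subset (M.parallelogram q)
        (M.planeCross_ne_zero q) hw
      have hs := hside i t ht
      have h1 : ‖f (M.vertex q i) - (z (M.corner q i) - z p₀) ^ m‖ ≤ E := hE _
      have h2 : ‖f (M.vertex q (i + 1)) - (z (M.corner q (i + 1)) - z p₀) ^ m‖ ≤ E := hE _
      have hd : ‖z (M.corner q (i + 1)) - z (M.corner q i)‖ = δ := by
        rw [← dist_eq_norm, dist_comm]; exact M.side_length q i
      have h3 := hI (z (M.corner q i) - z p₀) (z (M.corner q (i + 1)) - z (M.corner q i))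
        (hnorm _ _) (hnorm _ _) t ht
      rw [hd] at h3
      simp only [pts, Pi.sub_apply]
      rw [hs]
      generalize f (M.vertex q i) = fi at h1 ⊢
      generalize f (M.vertex q (i + 1)) = fj at h2 ⊢
      -- On a side the error is a convex combination of the errors at the two ends plus the error of
      -- linear interpolation of the power.
      have e : AffineMap.lineMap fi fj t - (AffineMap.lineMap (z (M.corner q i))
          (z (M.corner q (i + 1))) t - z p₀) ^ m =
          (((1 - t : ℝ) : ℂ) * (fi - (z (M.corner q i) - z p₀) ^ m) +
            (t : ℂ) * (fj - (z (M.corner q (i + 1)) - z p₀) ^ m)) +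
          (AffineMap.lineMap ((z (M.corner q i) - z p₀) ^ m)
            ((z (M.corner q i) - z p₀ + (z (M.corner q (i + 1)) - z (M.corner q i))) ^ m) t -
            (z (M.corner q i) - z p₀ + t * (z (M.corner q (i + 1)) - z (M.corner q i))) ^ m) := by
        rw [show z (M.corner q i) - z p₀ + (z (M.corner q (i + 1)) - z (M.corner q i)) =
            z (M.corner q (i + 1)) - z p₀ by ring,
          show AffineMap.lineMap (z (M.corner q i)) (z (M.corner q (i + 1))) t - z p₀ =
            z (M.corner q i) - z p₀ + t * (z (M.corner q (i + 1)) - z (M.corner q i)) by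
            simp [AffineMap.lineMap_apply]; ring]
        simp only [AffineMap.lineMap_apply, vsub_eq_sub, vadd_eq_add, Complex.real_smul]
        push_cast
        ring
      rw [e]
      refine (norm_add_le _ _).trans (add_le_add ((norm_add_le _ _).trans ?_) h3)
      rw [norm_mul, norm_mul, Complex.norm_real, Complex.norm_real, Real.norm_eq_abs,
        Real.norm_eq_abs, abs_of_nonneg (sub_nonneg.2 ht.2), abs_of_nonneg ht.1]
      nlinarith [mul_le_mul_of_nonneg_left h1 (sub_nonneg.2 ht.2),
        mul_le_mul_of_nonneg_left h2 ht.1])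
  rw [hgh p hpq]
  exact hmax (z p) ⟨p, hpq, rfl⟩

theorem ApproxWithin.trans_le {M : CriticalMap z δ} {f : M.vertices → ℂ} {F F' : U → ℂ}
    {ε ε' : ℝ} (h : M.ApproxWithin f F ε) (hF : ∀ p, ‖F p - F' p‖ ≤ ε') :
    M.ApproxWithin f F' (ε + ε') := by
  refine ⟨fun x => ?_, fun g hg p => ?_⟩
  · rw [← sub_add_sub_cancel _ (F x)]
    exact (norm_add_le _ _).trans (add_le_add (h.1 x) (hF x))
  · rw [← sub_add_sub_cancel _ (F p)]
    exact (norm_add_le _ _).trans (add_le_add (h.2 g hg p) (hF p))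

theorem ApproxWithin.mono {M : CriticalMap z δ} {f : M.vertices → ℂ} {F : U → ℂ}
    {ε ε' : ℝ} (h : M.ApproxWithin f F ε) (hε : ε ≤ ε') : M.ApproxWithin f F ε' :=
  ⟨fun x => (h.1 x).trans hε, fun g hg p => (h.2 g hg p).trans hε⟩

end CriticalMap

theorem mainTheorem3 {U : Type*} [TopologicalSpace U] [CompactSpace U] [T2Space U]
    [SimplyConnectedSpace U] (z : U → ℂ) (hz : IsDevelopingMap z)
    (δ : ℕ → ℝ) (M : ∀ n, CriticalMap z (δ n)) (hM : IsRefining M)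
    (O : U) (o : ∀ n, (M n).vertices) (ho : Tendsto (fun n => (o n : U)) atTop (𝓝 O)) :
    -- the discrete monomials are well defined: integration does not depend on the path
    (∀ n, (M n).graph.Connected ∧
      ∀ (m : ℕ) (x : (M n).vertices) (w : (M n).graph.Walk (o n) x),
        (M n).monomial (o n) (m + 1) x =
          (m + 1 : ℂ) * (M n).pathIntegral ((M n).monomial (o n) m) w) ∧
    ∀ m : ℕ,
      -- error of order `δ ^ 2` with respect to the power centred at the chosen origins
      (∃ C : ℝ, ∀ n,
        (M n).ApproxWithin ((M n).monomial (o n) m) (fun p => (z p - z (o n)) ^ m)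
          (C * δ n ^ 2)) ∧
      -- uniform convergence to the power centred at the limit of the origins
      (∀ ε > 0, ∀ᶠ n in atTop,
        (M n).ApproxWithin ((M n).monomial (o n) m) (fun p => (z p - z O) ^ m) ε) := by
  have hzc := hz.continuous
  refine ⟨fun n => ⟨(M n).graph_connected, fun m x w =>
    (M n).monomial_succ_eq_pathIntegral hzc (M n).graph_connected (o n) m x w⟩, fun m => ?_⟩
  obtain ⟨L, hL⟩ := hM.exists_walk_bound hz
  obtain ⟨R, hR⟩ := (isCompact_univ (X := U)).exists_bound_of_continuousOn hzc.continuousOn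
  replace hR : ∀ p, ‖z p‖ ≤ R := fun p => hR p trivial
  have hnorm : ∀ p p', ‖z p - z p'‖ ≤ 2 * R := fun p p' => by
    refine (norm_sub_le _ _).trans ?_
    linarith [hR p, hR p']
  obtain ⟨C, hC0, hC⟩ := CriticalMap.exists_vertex_error hzc R L hR m
  obtain ⟨I, hI0, hI⟩ := CriticalMap.exists_extension_error hzc R hR m
  have happrox : ∀ n, (M n).ApproxWithin ((M n).monomial (o n) m)
      (fun p => (z p - z (o n)) ^ m) ((C + I) * δ n ^ 2) := by
    intro n
    have hv := hC (δ n) (M n) (hL n) (o n)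
    refine ⟨fun x => (hv x).trans ?_, fun g hg p => ?_⟩
    · gcongr
      linarith
    · rw [add_mul]
      exact hI (δ n) (M n) (o n) _ _ hv g hg p
  refine ⟨⟨C + I, happrox⟩, fun ε hε => ?_⟩
  obtain ⟨K, hK0, hK⟩ := exists_lipschitz_bound m (2 * R)
  -- The second term is the cost of replacing the centre `z (o n)` by `z O`.
  have hlim : Tendsto (fun n => (C + I) * δ n ^ 2 + K * ‖z O - z (o n)‖) atTop (𝓝 0) := by
    have h1 : Tendsto (fun n => (C + I) * δ n ^ 2) atTop (𝓝 ((C + I) * 0 ^ 2)) :=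
      (hM.tendsto_side.pow 2).const_mul _
    have h2 : Tendsto (fun n => K * ‖z O - z (o n)‖) atTop (𝓝 (K * ‖z O - z O‖)) :=
      (tendsto_const_nhds.sub ((hzc.tendsto O).comp ho)).norm.const_mul _
    simpa using h1.add h2
  filter_upwards [hlim.eventually (gt_mem_nhds hε)] with n hn
  refine ((happrox n).trans_le (F' := fun p => (z p - z O) ^ m) fun p => ?_).mono hn.le
  have := hK (z p - z O) (z O - z (o n)) (hnorm _ _) (hnorm _ _)
  rwa [sub_add_sub_cancel] at this
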